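/- Proposition (non-co-Hopfian / co-Hopfian groups). Groups are regarded as structures in the signature $\{\cdot,{}^{-1},1\}$. A structure is computable if it is isomorphic to a structure with universe contained in $\omega$ whose atomic diagram (the set of Gödel numbers of its true atomic and negated atomic sentences) is computable. The index set $I(G)$ is the set of all $e\in\omega$ such that the partial computable function $\varphi_e$ is the characteristic function of the atomic diagram of a structure isomorphic to $G$, with universe contained in $\omega$. A group is co-Hopfian if it has no proper subgroup isomorphic to itself. An $\mathcal L_{\omega_1\omega}$ formula is computable if all its infinite conjunctions and disjunctions are (hereditarily, via Gödel numbers) over c.e. sets. The $\Sigma_0=\Pi_0$ formulas are the finitary quantifier-free ones; for $n>0$ a $\Sigma_n$ formula is a countable disjunction of formulas $\exists\bar x\,\psi$ with $\psi$ in $\Pi_m$ for some $m<n$, and a $\Pi_n$ formula is a countable conjunction of formulas $\forall\bar x\,\psi$ with $\psi$ in $\Sigma_m$ for some $m<n$. A d-$\Sigma_2$ formula is a conjunction of a $\Sigma_2$ formula and a $\Pi_2$ formula. A Scott sentence of $G$ is an $\mathcal L_{\omega_1\omega}$ sentence whose countable models (among all structures in the signature of groups) are exactly the isomorphic copies of $G$.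 Let $G$ be a computable finitely generated group. 1. If $G$ is not co-Hopfian, then $I(G)$ is $\Sigma_2$-hard: every $\Sigma_2$ set $S\subseteq\omega$ is many-one reducible to $I(G)$. 2. If $G$ is co-Hopfian, then $G$ has a computable d-$\Sigma_2$ Scott sentence. -/

import Mathlib

namespace CompGroup

open FirstOrder

/-! ### The signature of groups -/

/-- The function symbols of the signature of groups `{·, ⁻¹, 1}`. -/
inductive GroupFunc : ℕ → Type
  | one : GroupFunc 0
  | inv : GroupFunc 1
  | mul : GroupFunc 2

/-- The signature of groups: symbols for `1`, inverse and product, and no relation symbols. -/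
def GroupLang : FirstOrder.Language.{0, 0} :=
  ⟨GroupFunc, fun _ => Empty⟩

/-- A group is a structure for the signature of groups in the obvious way. -/
instance groupStructure (G : Type*) [Group G] : GroupLang.Structure G where
  funMap := fun {_} f =>
    match f with
    | GroupFunc.one => fun _ => 1
    | GroupFunc.inv => fun x => (x 0)⁻¹
    | GroupFunc.mul => fun x => x 0 * x 1
  RelMap := fun {_} r => Empty.elim r

/-- Gödel numbers of terms built from symbols indexed by natural numbers. These symbols serve as
the variables of formulas, and as the constants naming the elements of a structure whose universe
is a set of natural numbers. -/
def termCode : GroupLang.Term ℕ → ℕ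
  | .var n => Nat.pair 0 n
  | .func GroupFunc.one _ => Nat.pair 1 0
  | .func GroupFunc.inv ts => Nat.pair 2 (termCode (ts 0))
  | .func GroupFunc.mul ts => Nat.pair 3 (Nat.pair (termCode (ts 0)) (termCode (ts 1)))

/-! ### Partial computable functions and c.e. sets -/

/-- The `e`-th partial computable function `φ_e`. -/
def phi (e : ℕ) : ℕ →. ℕ :=
  (Denumerable.ofNat Nat.Partrec.Code e).eval

/-- The `e`-th computably enumerable set `W_e`, the domain of `φ_e`. -/
def ceSet (e : ℕ) : Set ℕ :=
  {n | (phi e n).Dom}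

/-! ### Computable structures and index sets -/

/-- The atomic diagram of a structure with universe `B ⊆ ℕ`: the atomic sentences `t = u` and the
negated atomic sentences `t ≠ u`, with constants for the elements of `B`, that hold in the
structure. The triple `(true, t, u)` stands for `t = u`, and `(false, t, u)` for `t ≠ u`. -/
def atomicDiagram (B : Set ℕ) [GroupLang.Structure B] :
    Set (Bool × GroupLang.Term ℕ × GroupLang.Term ℕ) :=
  {l | ∃ t u : GroupLang.Term B,
    l.2.1 = t.relabel Subtype.val ∧ l.2.2 = u.relabel Subtype.val ∧
    (l.1 = true ↔ t.realize (id : B → B) = u.realize (id : B → B))}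

/-- The set of Gödel numbers of the elements of the atomic diagram. -/
def diagramCodes (B : Set ℕ) [GroupLang.Structure B] : Set ℕ :=
  (fun l : Bool × GroupLang.Term ℕ × GroupLang.Term ℕ =>
    Nat.pair (if l.1 then 1 else 0) (Nat.pair (termCode l.2.1) (termCode l.2.2))) ''
      atomicDiagram B

/-- `f` is (total and) the characteristic function of the set `D`. -/
def IsCharFun (f : ℕ →. ℕ) (D : Set ℕ) : Prop :=
  ∀ n, (n ∈ D → 1 ∈ f n) ∧ (n ∉ D → 0 ∈ f n)

/-- The isomorphism type of `A` is computable: `A` is isomorphic to a structure with universe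
contained in `ℕ` whose atomic diagram is computable. -/
def IsComputableStructure (A : Type*) [GroupLang.Structure A] : Prop :=
  ∃ (B : Set ℕ) (_ : GroupLang.Structure B),
    ComputablePred (fun n => n ∈ diagramCodes B) ∧ Nonempty (B ≃[GroupLang] A)

/-- The index set `I(A)`: all `e` such that `φ_e` is (the characteristic function of) the atomic
diagram of a structure isomorphic to `A`. -/
def indexSet (A : Type*) [GroupLang.Structure A] : Set ℕ :=
  {e | ∃ (B : Set ℕ) (_ : GroupLang.Structure B),
    IsCharFun (phi e) (diagramCodes B) ∧ Nonempty (B ≃[GroupLang] A)}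

/-- `S` is a `Σ₂` set of natural numbers (in the arithmetical hierarchy). -/
def IsSigmaTwoSet (S : Set ℕ) : Prop :=
  ∃ R : ℕ × ℕ × ℕ → Prop, ComputablePred R ∧ ∀ n, n ∈ S ↔ ∃ x, ∀ y, R (n, x, y)

/-- `I` is `Σ₂`-hard: every `Σ₂` set is many-one reducible to `I`. -/
def IsSigmaTwoHard (I : Set ℕ) : Prop :=
  ∀ S : Set ℕ, IsSigmaTwoSet S → ManyOneReducible (fun n => n ∈ S) (fun e => e ∈ I)

/-! ### The infinitary language `L_{ω₁ω}` over the signature of groups -/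

/-- Formulas of `L_{ω₁ω}`, with variables `x₀, x₁, …`. Countable conjunctions and disjunctions are
indexed by sets of natural numbers. -/
inductive InfFormula : Type
  | equal (t u : GroupLang.Term ℕ) : InfFormula
  | neg (φ : InfFormula) : InfFormula
  | and (φ ψ : InfFormula) : InfFormula
  | or (φ ψ : InfFormula) : InfFormula
  | ex (i : ℕ) (φ : InfFormula) : InfFormula
  | all (i : ℕ) (φ : InfFormula) : InfFormula
  | conj (W : Set ℕ) (φ : W → InfFormula) : InfFormula
  | disj (W : Set ℕ) (φ : W → InfFormula) : InfFormula

namespace InfFormula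

/-- Truth of a formula in a structure under an assignment of the variables. -/
def Realize {M : Type*} [GroupLang.Structure M] : InfFormula → (ℕ → M) → Prop
  | equal t u, v => t.realize v = u.realize v
  | neg φ, v => ¬ φ.Realize v
  | and φ ψ, v => φ.Realize v ∧ ψ.Realize v
  | or φ ψ, v => φ.Realize v ∨ ψ.Realize v
  | ex i φ, v => ∃ a : M, φ.Realize (Function.update v i a)
  | all i φ, v => ∀ a : M, φ.Realize (Function.update v i a)
  | conj _ φ, v => ∀ w, (φ w).Realize v
  | disj _ φ, v => ∃ w, (φ w).Realize v

/-- The free variables of a formula. -/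
def freeVars : InfFormula → Set ℕ
  | equal t u => ↑t.varFinset ∪ ↑u.varFinset
  | neg φ => φ.freeVars
  | and φ ψ => φ.freeVars ∪ ψ.freeVars
  | or φ ψ => φ.freeVars ∪ ψ.freeVars
  | ex i φ => φ.freeVars \ {i}
  | all i φ => φ.freeVars \ {i}
  | conj _ φ => ⋃ w, (φ w).freeVars
  | disj _ φ => ⋃ w, (φ w).freeVars

/-- A sentence is a formula without free variables. -/
def IsSentence (φ : InfFormula) : Prop :=
  φ.freeVars = ∅

/-- `c` is a Gödel number of `φ`. The infinite conjunctions and disjunctions are given by indices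
of c.e. sets of Gödel numbers of the conjuncts, respectively disjuncts. -/
inductive HasCode : ℕ → InfFormula → Prop
  | equal (t u : GroupLang.Term ℕ) :
      HasCode (Nat.pair 0 (Nat.pair (termCode t) (termCode u))) (equal t u)
  | neg {c : ℕ} {φ : InfFormula} : HasCode c φ → HasCode (Nat.pair 1 c) (neg φ)
  | and {c d : ℕ} {φ ψ : InfFormula} : HasCode c φ → HasCode d ψ →
      HasCode (Nat.pair 2 (Nat.pair c d)) (and φ ψ)
  | or {c d : ℕ} {φ ψ : InfFormula} : HasCode c φ → HasCode d ψ →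
      HasCode (Nat.pair 3 (Nat.pair c d)) (or φ ψ)
  | ex (i : ℕ) {c : ℕ} {φ : InfFormula} : HasCode c φ →
      HasCode (Nat.pair 4 (Nat.pair i c)) (ex i φ)
  | all (i : ℕ) {c : ℕ} {φ : InfFormula} : HasCode c φ →
      HasCode (Nat.pair 5 (Nat.pair i c)) (all i φ)
  | conj (e : ℕ) {φ : ceSet e → InfFormula} : (∀ w : ceSet e, HasCode (w : ℕ) (φ w)) →
      HasCode (Nat.pair 6 e) (conj (ceSet e) φ)
  | disj (e : ℕ) {φ : ceSet e → InfFormula} : (∀ w : ceSet e, HasCode (w : ℕ) (φ w)) →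
      HasCode (Nat.pair 7 e) (disj (ceSet e) φ)

/-- A formula is computable if its infinite conjunctions and disjunctions are (hereditarily) over
c.e. sets, that is, if it has a Gödel number. -/
def IsComputable (φ : InfFormula) : Prop :=
  ∃ c, HasCode c φ

/-- Finitary quantifier-free formulas. -/
inductive IsQF : InfFormula → Prop
  | equal (t u : GroupLang.Term ℕ) : IsQF (equal t u)
  | neg {φ : InfFormula} : IsQF φ → IsQF (neg φ)
  | and {φ ψ : InfFormula} : IsQF φ → IsQF ψ → IsQF (and φ ψ)
  | or {φ ψ : InfFormula} : IsQF φ → IsQF ψ → IsQF (or φ ψ)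

/-- `∃ x̄, φ` for a finite tuple `x̄` of variables. -/
def exs (x : List ℕ) (φ : InfFormula) : InfFormula :=
  x.foldr ex φ

/-- `∀ x̄, φ` for a finite tuple `x̄` of variables. -/
def alls (x : List ℕ) (φ : InfFormula) : InfFormula :=
  x.foldr all φ

mutual

/-- `Σ_n` formulas of `L_{ω₁ω}`: for `n = 0` the finitary quantifier-free formulas, for `n > 0` the
countable disjunctions of formulas `∃ x̄, ψ` with `ψ` in `Π_m` for some `m < n`. -/
inductive IsSigma : ℕ → InfFormula → Prop
  | qf {φ : InfFormula} : IsQF φ → IsSigma 0 φ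
  | disj {n : ℕ} (W : Set ℕ) (x : W → List ℕ) (m : W → ℕ) (ψ : W → InfFormula) :
      (∀ w, m w < n + 1) → (∀ w, IsPi (m w) (ψ w)) →
      IsSigma (n + 1) (disj W fun w => exs (x w) (ψ w))

/-- `Π_n` formulas of `L_{ω₁ω}`: for `n = 0` the finitary quantifier-free formulas, for `n > 0` the
countable conjunctions of formulas `∀ x̄, ψ` with `ψ` in `Σ_m` for some `m < n`. -/
inductive IsPi : ℕ → InfFormula → Prop
  | qf {φ : InfFormula} : IsQF φ → IsPi 0 φ
  | conj {n : ℕ} (W : Set ℕ) (x : W → List ℕ) (m : W → ℕ) (ψ : W → InfFormula) :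
      (∀ w, m w < n + 1) → (∀ w, IsSigma (m w) (ψ w)) →
      IsPi (n + 1) (conj W fun w => alls (x w) (ψ w))

end

/-- `d-Σ_n` formulas: conjunctions of a `Σ_n` formula and a `Π_n` formula. -/
def IsDSigma (n : ℕ) (φ : InfFormula) : Prop :=
  ∃ σ π : InfFormula, IsSigma n σ ∧ IsPi n π ∧ φ = and σ π

/-- `φ` is a Scott sentence for `A`: it is a sentence whose countable models are exactly the
isomorphic copies of `A`, among all structures for the signature of groups. -/
def IsScottSentence.{u} (φ : InfFormula) (A : Type u) [GroupLang.Structure A] : Prop :=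
  φ.IsSentence ∧ ∀ (M : Type u) [GroupLang.Structure M] [Countable M],
    (∀ v : ℕ → M, φ.Realize v) ↔ Nonempty (M ≃[GroupLang] A)

end InfFormula

/-- A group is co-Hopfian if it has no proper subgroup isomorphic to it. -/
def IsCoHopfian (G : Type*) [Group G] : Prop :=
  ∀ H : Subgroup G, Nonempty (H ≃* G) → H = ⊤

end CompGroup

namespace CompGroup

open FirstOrder

universe u

-- If `G` is not co-Hopfian, it has an injective, non-surjective endomorphism `f`. For a `Σ₂` set
-- given by `∃ x, ∀ y, R (n, x, y)`, let `c n s` be the number of candidates `x` refuted by stage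
-- `s` of a search. Then `c n` is eventually constant iff `n ∈ S` (`exists_forall_iff_searchState`).
-- Let `A n` be the direct limit of copies of `G` along the maps `f ^ (c n t - c n s)`. If `c n`
-- stabilizes, `A n` is isomorphic to `G`. Otherwise `A n` is the union of an increasing chain of
-- subgroups that never stabilizes, hence is not finitely generated and not isomorphic to `G`. Two
-- words in the generators of `A n` are compared by pushing both to a common late stage and solving
-- the word problem of `G` there, so the `A n` have uniformly computable copies
-- (`exists_computable_index`). The map from `n` to an index of the copy of `A n` is the reduction.
--
-- If `G` is co-Hopfian, generated by `γ 0, …, γ (k - 1)`, the Scott sentence says that some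
-- `k`-tuple has the atomic type of these generators, and that every `k`-tuple of this type
-- generates the structure. Atomic types are computable `Π₁` because the word problem is decidable.
-- A model is generated by a tuple of the right type, which determines it up to isomorphism
-- (`SameAtomicType.nonempty_equiv`). Conversely, a tuple of this type in `G` generates a subgroup
-- isomorphic to `G`, hence all of `G` (`IsCoHopfian.exists_realize_eq`).

/-! ### Terms and their Gödel numbers -/

/-- The term `1`. -/
def tOne {α : Type*} : GroupLang.Term α := .func GroupFunc.one Fin.elim0

/-- The term `t⁻¹`. -/
def tInv {α : Type*} (t : GroupLang.Term α) : GroupLang.Term α := .func GroupFunc.inv fun _ => t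

/-- The term `t * u`. -/
def tMul {α : Type*} (t u : GroupLang.Term α) : GroupLang.Term α :=
  .func GroupFunc.mul ![t, u]

/-- Normalizes the argument tuples, which are functions on `Fin n`, so that inductions meet only the
forms covered by the simp lemmas. -/
theorem term_induction {α : Type*} {P : GroupLang.Term α → Prop} (var : ∀ a, P (.var a))
    (one : P tOne) (inv : ∀ t, P t → P (tInv t)) (mul : ∀ t u, P t → P u → P (tMul t u)) :
    ∀ t, P t
  | .var a => var a
  | .func GroupFunc.one ts => by
    rw [Subsingleton.elim ts Fin.elim0]; exact one
  | .func GroupFunc.inv ts => by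
    have h : ts = fun _ => ts 0 := by
      funext i; rw [Subsingleton.elim i 0]
    rw [h]; exact inv _ (term_induction var one inv mul (ts 0))
  | .func GroupFunc.mul ts => by
    have h : ts = ![ts 0, ts 1] := by
      funext i; fin_cases i <;> rfl
    rw [h]
    exact mul _ _ (term_induction var one inv mul (ts 0)) (term_induction var one inv mul (ts 1))

section Interpretations

variable {M : Type*} [GroupLang.Structure M]

/-- The interpretation of `1`. -/
def sOne : M := Language.Structure.funMap (L := GroupLang) GroupFunc.one Fin.elim0

/-- The interpretation of the inverse. -/
def sInv (x : M) : M := Language.Structure.funMap (L := GroupLang) GroupFunc.inv fun _ => x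

/-- The interpretation of the product. -/
def sMul (x y : M) : M := Language.Structure.funMap (L := GroupLang) GroupFunc.mul ![x, y]

variable {α : Type*} (v : α → M)

@[simp] theorem realize_tOne : (tOne : GroupLang.Term α).realize v = sOne := by
  simp only [tOne, sOne, Language.Term.realize]; congr 1; funext i; exact i.elim0

@[simp] theorem realize_tInv (t : GroupLang.Term α) :
    (tInv t).realize v = sInv (t.realize v) := rfl

@[simp] theorem realize_tMul (t u : GroupLang.Term α) :
    (tMul t u).realize v = sMul (t.realize v) (u.realize v) := by
  simp only [tMul, sMul, Language.Term.realize]; congr 1; funext i; fin_cases i <;> rfl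

end Interpretations

@[simp] theorem sOne_group {G : Type*} [Group G] : (sOne : G) = 1 := rfl

@[simp] theorem sInv_group {G : Type*} [Group G] (x : G) : sInv x = x⁻¹ := rfl

@[simp] theorem sMul_group {G : Type*} [Group G] (x y : G) : sMul x y = x * y := rfl

section Relabel

variable {α β : Type*} (g : α → β)

@[simp] theorem relabel_tOne : (tOne : GroupLang.Term α).relabel g = tOne := by
  simp only [tOne, Language.Term.relabel]; congr 1; funext i; exact i.elim0

@[simp] theorem relabel_tInv (t : GroupLang.Term α) :
    (tInv t).relabel g = tInv (t.relabel g) := rfl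

@[simp] theorem relabel_tMul (t u : GroupLang.Term α) :
    (tMul t u).relabel g = tMul (t.relabel g) (u.relabel g) := by
  simp only [tMul, Language.Term.relabel]; congr 1; funext i; fin_cases i <;> rfl

end Relabel

@[simp] theorem varFinset_tOne {α : Type*} [DecidableEq α] :
    (tOne : GroupLang.Term α).varFinset = ∅ := rfl

@[simp] theorem varFinset_tInv {α : Type*} [DecidableEq α] (t : GroupLang.Term α) :
    (tInv t).varFinset = t.varFinset := by
  ext; simp [tInv, Language.Term.varFinset]

@[simp] theorem varFinset_tMul {α : Type*} [DecidableEq α] (t u : GroupLang.Term α) :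
    (tMul t u).varFinset = t.varFinset ∪ u.varFinset := by
  ext; simp [tMul, Language.Term.varFinset, Fin.exists_fin_two]

@[simp] theorem termCode_var (n : ℕ) : termCode (.var n) = Nat.pair 0 n := by simp [termCode]

@[simp] theorem termCode_tOne : termCode tOne = Nat.pair 1 0 := by simp [termCode, tOne]

@[simp] theorem termCode_tInv (t : GroupLang.Term ℕ) :
    termCode (tInv t) = Nat.pair 2 (termCode t) := by simp [termCode, tInv]

@[simp] theorem termCode_tMul (t u : GroupLang.Term ℕ) :
    termCode (tMul t u) = Nat.pair 3 (Nat.pair (termCode t) (termCode u)) := by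
  simp [termCode, tMul]

theorem unpair_snd_lt {c : ℕ} (h : c.unpair.1 ≠ 0) : c.unpair.2 < c := by
  have := Nat.add_le_pair c.unpair.1 c.unpair.2
  rw [Nat.pair_unpair] at this; omega

/-- The term with Gödel number `c`; numbers that are not Gödel numbers are given junk values. -/
def ofCode (c : ℕ) : GroupLang.Term ℕ :=
  if c.unpair.1 = 0 then .var c.unpair.2
  else if _h : c.unpair.1 = 2 then tInv (ofCode c.unpair.2)
  else if _h : c.unpair.1 = 3 then
    tMul (ofCode c.unpair.2.unpair.1) (ofCode c.unpair.2.unpair.2)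
  else tOne
termination_by c
decreasing_by
  · exact unpair_snd_lt (by omega)
  · exact (Nat.unpair_left_le _).trans_lt (unpair_snd_lt (by omega))
  · exact (Nat.unpair_right_le _).trans_lt (unpair_snd_lt (by omega))

@[simp] theorem ofCode_var (n : ℕ) : ofCode (Nat.pair 0 n) = .var n := by
  rw [ofCode]; simp

@[simp] theorem ofCode_one (n : ℕ) : ofCode (Nat.pair 1 n) = tOne := by
  rw [ofCode]; simp

@[simp] theorem ofCode_inv (c : ℕ) : ofCode (Nat.pair 2 c) = tInv (ofCode c) := by
  rw [ofCode]; simp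

@[simp] theorem ofCode_mul (c d : ℕ) :
    ofCode (Nat.pair 3 (Nat.pair c d)) = tMul (ofCode c) (ofCode d) := by
  rw [ofCode]; simp

@[simp] theorem ofCode_termCode (t : GroupLang.Term ℕ) : ofCode (termCode t) = t := by
  induction t using term_induction <;> simp_all

theorem termCode_injective : Function.Injective termCode :=
  Function.LeftInverse.injective ofCode_termCode

/-! ### Computable recursion on terms -/

/-- Evaluation of a term with prescribed values of the variables and operations. -/
def foldTerm {α σ : Type*} (o : σ) (I : σ → σ) (M : σ → σ → σ) (v : α → σ) :
    GroupLang.Term α → σ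
  | .var n => v n
  | .func GroupFunc.one _ => o
  | .func GroupFunc.inv ts => I (foldTerm o I M v (ts 0))
  | .func GroupFunc.mul ts => M (foldTerm o I M v (ts 0)) (foldTerm o I M v (ts 1))

section Fold

variable {α σ : Type*} (o : σ) (I : σ → σ) (M : σ → σ → σ) (v : α → σ)

@[simp] theorem foldTerm_var (a : α) : foldTerm o I M v (.var a) = v a := by simp [foldTerm]

@[simp] theorem foldTerm_tOne : foldTerm o I M v tOne = o := by simp [foldTerm, tOne]

@[simp] theorem foldTerm_tInv (t : GroupLang.Term α) :
    foldTerm o I M v (tInv t) = I (foldTerm o I M v t) := by simp [foldTerm, tInv]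

@[simp] theorem foldTerm_tMul (t u : GroupLang.Term α) :
    foldTerm o I M v (tMul t u) = M (foldTerm o I M v t) (foldTerm o I M v u) := by
  simp [foldTerm, tMul]

end Fold

/-- Codes of immediate subterms are smaller numbers, so this is course-of-values recursion on the
code. -/
theorem computable_foldTerm {α σ : Type*} [Primcodable α] [Primcodable σ] {o : σ} {I : σ → σ}
    {M : σ → σ → σ} {v : α → ℕ → σ} (hI : Computable I) (hM : Computable₂ M)
    (hv : Computable₂ v) :
    Computable₂ fun a c => foldTerm o I M (v a) (ofCode c) := by
  -- `l` lists the values at all smaller codes, so `l.length` is the code being evaluated.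
  let g : α → List σ → Option σ := fun a l =>
    bif l.length.unpair.1 == 0 then some (v a l.length.unpair.2)
    else bif l.length.unpair.1 == 2 then l[l.length.unpair.2]?.map I
    else bif l.length.unpair.1 == 3 then
      l[l.length.unpair.2.unpair.1]?.bind fun x => l[l.length.unpair.2.unpair.2]?.map (M x)
    else some o
  have hlen : Computable fun p : α × List σ => p.2.length := Computable.list_length.comp .snd
  have h1 : Computable fun p : α × List σ => p.2.length.unpair.1 :=
    Computable.fst.comp (Computable.unpair.comp hlen)
  have h2 : Computable fun p : α × List σ => p.2.length.unpair.2 :=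
    Computable.snd.comp (Computable.unpair.comp hlen)
  have htag : ∀ k : ℕ, Computable fun p : α × List σ => p.2.length.unpair.1 == k := fun k =>
    Primrec.beq.to_comp.comp h1 (.const k)
  have hg : Computable₂ g := by
    refine Computable.cond (htag 0) ?_ (Computable.cond (htag 2) ?_
      (Computable.cond (htag 3) ?_ (.const _)))
    · exact Computable.option_some.comp (hv.comp .fst h2)
    · exact Computable.option_map (Computable.list_getElem?.comp .snd h2)
        (hI.comp .snd).to₂
    · refine Computable.option_bind (Computable.list_getElem?.comp .snd
        (Computable.fst.comp (Computable.unpair.comp h2))) ?_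
      refine Computable.option_map (Computable.list_getElem?.comp (Computable.snd.comp .fst)
        ((Computable.snd.comp (Computable.unpair.comp h2)).comp .fst)) ?_
      exact hM.comp (Computable.snd.comp .fst) .snd
  refine Computable.nat_strong_rec _ hg fun a n => ?_
  simp only [g, List.length_map, List.length_range]
  rw [ofCode]
  by_cases t0 : n.unpair.1 = 0
  · simp [t0]
  have hlt := unpair_snd_lt t0
  by_cases t2 : n.unpair.1 = 2
  · simp [t2, hlt]
  by_cases t3 : n.unpair.1 = 3
  · have hl := (Nat.unpair_left_le n.unpair.2).trans_lt hlt
    have hr := (Nat.unpair_right_le n.unpair.2).trans_lt hlt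
    simp [t3, hl, hr]
  · simp only [t0, t2, t3, beq_eq_false_iff_ne.2 t0, beq_eq_false_iff_ne.2 t2,
      beq_eq_false_iff_ne.2 t3, cond_false, if_false, dite_false, foldTerm_tOne]

/-- Substitution of terms, given by their Gödel numbers, for the variables of a term. -/
def subst (v : ℕ → ℕ) (t : GroupLang.Term ℕ) : ℕ :=
  foldTerm (Nat.pair 1 0) (Nat.pair 2) (fun x y => Nat.pair 3 (Nat.pair x y)) v t

theorem computable_subst {α : Type*} [Primcodable α] {v : α → ℕ → ℕ} (hv : Computable₂ v) :
    Computable₂ fun a c => subst (v a) (ofCode c) := by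
  have hp : Computable₂ Nat.pair := Primrec₂.natPair.to_comp
  exact computable_foldTerm (hp.comp (.const 2) .id)
    (hp.comp (.const 3) (hp.comp .fst .snd)).to₂ hv

theorem realize_subst {M : Type*} [GroupLang.Structure M] (w : ℕ → M) (v : ℕ → ℕ)
    (t : GroupLang.Term ℕ) :
    (ofCode (subst v t)).realize w = t.realize fun n => (ofCode (v n)).realize w := by
  induction t using term_induction <;> simp_all [subst]

theorem subst_eq_relabel {α : Type*} (t : GroupLang.Term α) (g : α → ℕ) (v : ℕ → ℕ)
    (h : α → ℕ) (hv : ∀ a, v (g a) = Nat.pair 0 (h a)) :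
    subst v (t.relabel g) = termCode (t.relabel h) := by
  induction t using term_induction <;> simp_all [subst, Language.Term.relabel]

/-- Makes `termCode (ofCode c)` computable in `c`, so that junk codes can be recognized. -/
theorem subst_var (t : GroupLang.Term ℕ) : subst (Nat.pair 0) t = termCode t := by
  induction t using term_induction <;> simp_all [subst]

/-! ### Terms with variables from a given set -/

/-- Replaces an existential by a recursion on `t`, which can be carried out computably when `U` is
decidable. -/
theorem exists_relabel_val {U : Set ℕ} {t : GroupLang.Term ℕ} :
    (∃ u : GroupLang.Term U, t = u.relabel Subtype.val) ↔
      foldTerm True id And (· ∈ U) t := by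
  constructor
  · rintro ⟨u, rfl⟩
    induction u using term_induction <;> simp_all [Language.Term.relabel]
  · induction t using term_induction with
    | var a => exact fun h => ⟨.var ⟨a, by simpa using h⟩, rfl⟩
    | one => exact fun _ => ⟨tOne, by simp⟩
    | inv t ih =>
      intro h
      obtain ⟨u, rfl⟩ := ih (by simpa using h)
      exact ⟨tInv u, by simp⟩
    | mul t u iht ihu =>
      intro h
      simp only [foldTerm_tMul] at h
      obtain ⟨t, rfl⟩ := iht h.1
      obtain ⟨u, rfl⟩ := ihu h.2
      exact ⟨tMul t u, by simp⟩

theorem varFinset_relabel_val {U : Set ℕ} (u : GroupLang.Term U) :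
    (↑(u.relabel Subtype.val).varFinset : Set ℕ) ⊆ U := by
  induction u using term_induction <;>
    simp_all [Language.Term.relabel, Language.Term.varFinset]

theorem relabel_val_injective {U : Set ℕ} :
    Function.Injective (Language.Term.relabel Subtype.val : GroupLang.Term U → _) := by
  classical
  refine Function.LeftInverse.injective (g := foldTerm tOne tInv tMul
    fun n => if h : n ∈ U then .var ⟨n, h⟩ else tOne) fun t => ?_
  induction t using term_induction <;> simp_all [Language.Term.relabel]

/-- `c` is the Gödel number of a term with variables in `U`. -/
def IsTermCode (U : Set ℕ) (c : ℕ) : Prop :=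
  ∃ u : GroupLang.Term U, c = termCode (u.relabel Subtype.val)

theorem isTermCode_iff {U : Set ℕ} {c : ℕ} :
    IsTermCode U c ↔ termCode (ofCode c) = c ∧ foldTerm True id And (· ∈ U) (ofCode c) := by
  rw [← exists_relabel_val]
  constructor
  · rintro ⟨u, rfl⟩
    simp
  · rintro ⟨h, u, hu⟩
    exact ⟨u, by rw [← h, hu]⟩

theorem computablePred_isTermCode {α : Type*} [Primcodable α] {U : α → Set ℕ}
    (hU : ComputablePred fun p : α × ℕ => p.2 ∈ U p.1) :
    ComputablePred fun p : α × ℕ => IsTermCode (U p.1) p.2 := by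
  classical
  obtain ⟨_, hU⟩ := hU
  have h1 : Computable₂ fun (a : α) (c : ℕ) => foldTerm true id and
      (fun n => decide (n ∈ U a)) (ofCode c) :=
    computable_foldTerm .id Primrec.and.to_comp (hU.of_eq fun p => by congr)
  have h2 : Computable fun p : α × ℕ => subst (Nat.pair 0) (ofCode p.2) :=
    computable_subst (v := fun _ : α => Nat.pair 0)
      ((Primrec₂.natPair.to_comp : Computable₂ Nat.pair).comp (.const 0) .snd).to₂
  have h3 : Computable fun p : α × ℕ => subst (Nat.pair 0) (ofCode p.2) == p.2 :=
    Primrec.beq.to_comp.comp h2 .snd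
  refine ⟨fun _ => Classical.propDecidable _, (Primrec.and.to_comp.comp h3 h1).of_eq fun p => ?_⟩
  have h4 : ∀ t : GroupLang.Term ℕ, (foldTerm true id and (fun n => decide (n ∈ U p.1)) t = true ↔
      foldTerm True id And (· ∈ U p.1) t) := by
    intro t
    induction t using term_induction <;> simp_all
  rw [Bool.eq_iff_iff]
  simp [isTermCode_iff, subst_var, h4]

/-! ### Closure properties of computable predicates -/

section ComputablePred

variable {α β : Type*} [Primcodable α] [Primcodable β]

theorem computablePred_comp {p : β → Prop} (hp : ComputablePred p) {f : α → β}
    (hf : Computable f) : ComputablePred fun a => p (f a) := by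
  obtain ⟨_, hp⟩ := hp
  exact ⟨inferInstance, hp.comp hf⟩

theorem computablePred_and {p q : α → Prop} (hp : ComputablePred p) (hq : ComputablePred q) :
    ComputablePred fun a => p a ∧ q a := by
  obtain ⟨_, hp⟩ := hp
  obtain ⟨_, hq⟩ := hq
  exact ⟨inferInstance, (Primrec.and.to_comp.comp hp hq).of_eq fun a => by simp⟩

theorem computablePred_or {p q : α → Prop} (hp : ComputablePred p) (hq : ComputablePred q) :
    ComputablePred fun a => p a ∨ q a := by
  obtain ⟨_, hp⟩ := hp
  obtain ⟨_, hq⟩ := hq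
  exact ⟨inferInstance, (Primrec.or.to_comp.comp hp hq).of_eq fun a => by simp⟩

theorem computablePred_eq {f g : α → ℕ} (hf : Computable f) (hg : Computable g) :
    ComputablePred fun a => f a = g a :=
  computablePred_comp (p := fun x : ℕ × ℕ => x.1 = x.2)
    (PrimrecPred.computablePred (Primrec.eq (α := ℕ))) (hf.pair hg)

theorem computable_list_lookup (l : List ℕ) (d : ℕ) : Computable fun i : ℕ => l[i]?.getD d :=
  (Primrec.option_getD.comp (Primrec.list_getElem?.comp (.const l) .id) (.const d)).to_comp

theorem computable_unpair_fst : Computable fun z : ℕ => z.unpair.1 :=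
  Computable.fst.comp Computable.unpair

theorem computable_unpair_snd : Computable fun z : ℕ => z.unpair.2 :=
  Computable.snd.comp Computable.unpair

end ComputablePred

theorem exists_phi_eq {f : ℕ →. ℕ} (hf : Partrec f) : ∃ e, phi e = f := by
  obtain ⟨c, rfl⟩ := Nat.Partrec.Code.exists_code.1 (Partrec.nat_iff.1 hf)
  exact ⟨Encodable.encode c, by simp [phi]⟩

theorem exists_ceSet_eq {W : Set ℕ} (hW : ComputablePred (· ∈ W)) : ∃ e, ceSet e = W := by
  have h : Partrec fun n : ℕ => (Part.assert (n ∈ W) fun _ => Part.some ()).map fun _ => (0 : ℕ) :=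
    hW.to_re.map (Computable.const 0).to₂
  obtain ⟨e, he⟩ := exists_phi_eq h
  refine ⟨e, Set.ext fun n => ?_⟩
  simp [ceSet, he, Part.assert]

/-- The s-m-n theorem for the characteristic functions of a uniformly computable family. -/
theorem exists_index_isCharFun {D : ℕ → Set ℕ}
    (hD : ComputablePred fun p : ℕ × ℕ => p.2 ∈ D p.1) :
    ∃ h : ℕ → ℕ, Computable h ∧ ∀ n, IsCharFun (phi (h n)) (D n) := by
  classical
  obtain ⟨_, hD⟩ := hD
  have hf : Computable fun z : ℕ => bif decide (z.unpair.2 ∈ D z.unpair.1) then 1 else 0 :=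
    Computable.cond (hD.comp Computable.unpair) (.const 1) (.const 0)
  obtain ⟨c, hc⟩ := Nat.Partrec.Code.exists_code.1 (Partrec.nat_iff.1 hf.partrec)
  refine ⟨fun n => Encodable.encode (c.curry n), Computable.encode.comp
    (Nat.Partrec.Code.primrec₂_curry.to_comp.comp (.const c) .id), fun n z => ?_⟩
  have : phi (Encodable.encode (c.curry n)) z =
      Part.some (bif decide (z ∈ D n) then 1 else 0) := by
    simp [phi, Nat.Partrec.Code.eval_curry, hc]
  rw [this]
  by_cases hz : z ∈ D n <;> simp [hz]

/-! ### Atomic diagrams -/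

theorem realize_equiv {M N α : Type*} [GroupLang.Structure M] [GroupLang.Structure N]
    (e : M ≃[GroupLang] N) (v : α → M) (t : GroupLang.Term α) :
    t.realize (fun a => e (v a)) = e (t.realize v) :=
  Language.HomClass.realize_term e

theorem mem_diagramCodes_iff {B : Set ℕ} [GroupLang.Structure B] {z : ℕ} :
    z ∈ diagramCodes B ↔ ∃ t u : GroupLang.Term B,
      z.unpair.2.unpair.1 = termCode (t.relabel Subtype.val) ∧
      z.unpair.2.unpair.2 = termCode (u.relabel Subtype.val) ∧
      ((z.unpair.1 = 1 ∧ t.realize (id : B → B) = u.realize (id : B → B)) ∨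
        (z.unpair.1 = 0 ∧ t.realize (id : B → B) ≠ u.realize (id : B → B))) := by
  constructor
  · rintro ⟨⟨b, _, _⟩, ⟨t, u, rfl, rfl, h⟩, rfl⟩
    refine ⟨t, u, ?_⟩
    cases b <;> simpa using h
  · rintro ⟨t, u, ht, hu, h⟩
    refine ⟨(decide (z.unpair.1 = 1), t.relabel Subtype.val, u.relabel Subtype.val),
      ⟨t, u, rfl, rfl, ?_⟩, ?_⟩
    · rcases h with h | h <;> simp [h]
    · have hz : (if decide (z.unpair.1 = 1) = true then 1 else 0) = z.unpair.1 := by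
        rcases h with h | h <;> simp [h]
      simp only [hz, ← ht, ← hu, Nat.pair_unpair]

theorem pair_mem_diagramCodes_iff {B : Set ℕ} [GroupLang.Structure B] (t u : GroupLang.Term B) :
    Nat.pair 1 (Nat.pair (termCode (t.relabel Subtype.val)) (termCode (u.relabel Subtype.val))) ∈
      diagramCodes B ↔ t.realize (id : B → B) = u.realize (id : B → B) := by
  rw [mem_diagramCodes_iff]
  constructor
  · rintro ⟨t', u', ht, hu, h⟩
    simp only [Nat.unpair_pair] at ht hu h
    rw [relabel_val_injective (termCode_injective ht),
      relabel_val_injective (termCode_injective hu)]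
    simpa using h
  · exact fun h => ⟨t, u, by simp [h]⟩

/-- The universe can be read off the diagram: `m` belongs to it exactly when the sentence `m = m`
occurs. -/
theorem subset_of_diagramCodes_eq {B C : Set ℕ} [GroupLang.Structure B] [GroupLang.Structure C]
    (h : diagramCodes B = diagramCodes C) : B ⊆ C := by
  intro m hm
  have h1 := (pair_mem_diagramCodes_iff (.var (⟨m, hm⟩ : B)) (.var ⟨m, hm⟩)).2 rfl
  rw [h, mem_diagramCodes_iff] at h1
  obtain ⟨t, -, ht, -⟩ := h1
  have := congrArg ofCode ht
  simp only [Nat.unpair_pair, ofCode_termCode] at this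
  have h2 := varFinset_relabel_val t
  rw [← this] at h2
  simpa [Language.Term.relabel, Language.Term.varFinset] using h2

theorem funMap_eq_of_diagramCodes_eq {B : Set ℕ} {s s' : GroupLang.Structure B}
    (h : @diagramCodes B s = @diagramCodes B s') {n : ℕ} (f : GroupLang.Functions n)
    (x : Fin n → B) : s.funMap f x = s'.funMap f x := by
  have h1 : Nat.pair 1 (Nat.pair
      (termCode ((Language.Term.func f fun i => .var (x i) : GroupLang.Term B).relabel
        Subtype.val))
      (termCode ((Language.Term.var (s.funMap f x) : GroupLang.Term B).relabel
        Subtype.val))) ∈ @diagramCodes B s := by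
    let _ := s
    exact (pair_mem_diagramCodes_iff _ _).2 rfl
  rw [h] at h1
  -- The value must become an opaque constant before the sentence is read in the other structure.
  generalize s.funMap f x = y at h1
  let _ := s'
  exact ((pair_mem_diagramCodes_iff _ _).1 h1).symm

theorem equiv_of_diagramCodes_eq {B C : Set ℕ} [iB : GroupLang.Structure B]
    [iC : GroupLang.Structure C] (h : diagramCodes B = diagramCodes C) :
    Nonempty (B ≃[GroupLang] C) := by
  obtain rfl : B = C :=
    (subset_of_diagramCodes_eq h).antisymm (subset_of_diagramCodes_eq h.symm)
  exact ⟨@Language.Equiv.mk GroupLang B B iB iC (Equiv.refl _)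
    (funMap_eq_of_diagramCodes_eq h) fun r => r.elim⟩

/-- The word problem for a finite tuple is decidable: substitute the names of its entries in a
computable copy, a finite table of numbers, and look the equation up in the diagram. -/
theorem computablePred_realize_eq {G : Type*} [GroupLang.Structure G]
    (hG : IsComputableStructure G) (l : List G) (d : G) :
    ComputablePred fun p : ℕ × ℕ => (ofCode p.1).realize (fun i => l[i]?.getD d) =
      (ofCode p.2).realize (fun i => l[i]?.getD d) := by
  obtain ⟨B, _, hB, ⟨e⟩⟩ := hG
  let b : ℕ → B := fun i => e.symm (l[i]?.getD d)
  have hb : Computable fun i => Nat.pair 0 (b i) := by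
    refine (Primrec₂.natPair.to_comp : Computable₂ Nat.pair).comp (.const 0)
      ((computable_list_lookup (l.map fun g => (e.symm g : ℕ)) (e.symm d)).of_eq fun i => ?_)
    simp only [b, List.getElem?_map]
    cases l[i]? <;> rfl
  have hs : Computable fun c => subst (fun i => Nat.pair 0 (b i)) (ofCode c) :=
    (computable_subst (v := fun _ : Unit => fun i => Nat.pair 0 (b i))
      (hb.comp .snd).to₂).comp (.const ()) .id
  have hp : Computable₂ Nat.pair := Primrec₂.natPair.to_comp
  have key : ∀ t : GroupLang.Term ℕ, subst (fun i => Nat.pair 0 (b i)) t =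
      termCode ((t.relabel b).relabel Subtype.val) := fun t => by
    have := subst_eq_relabel t id (fun i => Nat.pair 0 (b i)) (fun i => (b i : ℕ)) fun _ => rfl
    rw [Language.Term.relabel_relabel]
    simpa [Function.comp_def] using this
  have hr : ∀ t : GroupLang.Term ℕ, (t.relabel b).realize (id : B → B) =
      e.symm (t.realize fun i => l[i]?.getD d) := fun t => by
    rw [Language.Term.realize_relabel, ← realize_equiv]
    rfl
  refine (computablePred_comp hB (hp.comp (.const 1) (hp.comp (hs.comp .fst)
    (hs.comp .snd)))).of_eq fun p => ?_
  simp only [key]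
  rw [pair_mem_diagramCodes_iff, hr, hr, e.symm.injective.eq_iff]

/-! ### Uniformly computable copies -/

/-- Every element is named by terms in the generators; taking the least number naming it gives a
decidable universe, uniformly in `n`, to which the structure is transported. -/
theorem exists_computable_index {A : ℕ → Type u} [∀ n, GroupLang.Structure (A n)]
    (w : ∀ n, ℕ → A n) (hw : ∀ n a, ∃ t : GroupLang.Term ℕ, t.realize (w n) = a)
    (heq : ComputablePred fun p : ℕ × ℕ × ℕ =>
      (ofCode p.2.1).realize (w p.1) = (ofCode p.2.2).realize (w p.1)) :
    ∃ h : ℕ → ℕ, Computable h ∧ ∀ n, ∃ (B : Set ℕ) (_ : GroupLang.Structure B),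
      IsCharFun (phi (h n)) (diagramCodes B) ∧ Nonempty (B ≃[GroupLang] A n) := by
  classical
  let r : ∀ n, ℕ → A n := fun n c => (ofCode c).realize (w n)
  have hex : ∀ p : ℕ × ℕ, ∃ m, r p.1 m = r p.1 p.2 := fun p => ⟨p.2, rfl⟩
  let U : ℕ → Set ℕ := fun n => {m | Nat.find (hex (n, m)) = m}
  have hU : ComputablePred fun p : ℕ × ℕ => p.2 ∈ U p.1 := by
    have h1 : ComputablePred fun q : (ℕ × ℕ) × ℕ => r q.1.1 q.2 = r q.1.1 q.1.2 :=
      computablePred_comp heq ((Computable.fst.comp .fst).pair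
        (Computable.snd.pair (Computable.snd.comp .fst)))
    have h2 := Computable.find (P := fun (p : ℕ × ℕ) m => r p.1 m = r p.1 p.2) h1 hex
    exact computablePred_eq h2 Computable.snd
  have hbij : ∀ n, Function.Bijective fun m : U n => r n m := by
    intro n
    constructor
    · rintro ⟨m, hm⟩ ⟨m', hm'⟩ h
      simp only at h
      simp only [Subtype.mk.injEq]
      simp only [U, Set.mem_ofPred_eq] at hm hm'
      rw [← hm, ← hm']
      simp only [h]
    · intro a
      obtain ⟨t, rfl⟩ := hw n a
      have hs := Nat.find_spec (hex (n, termCode t))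
      refine ⟨⟨Nat.find (hex (n, termCode t)), ?_⟩, by simpa [r] using hs⟩
      simp only [U, Set.mem_ofPred_eq]
      simp only at hs
      simp only [hs]
  let e : ∀ n, U n ≃ A n := fun n => Equiv.ofBijective _ (hbij n)
  let inst : ∀ n, GroupLang.Structure (U n) := fun n => (e n).symm.inducedStructure
  let E : ∀ n, A n ≃[GroupLang] U n := fun n => (e n).symm.inducedStructureEquiv
  -- The elements of `U n` are themselves read as codes of terms, so `subst id` expands each
  -- constant into the term it codes.
  have hE : ∀ n (t : GroupLang.Term (U n)), (E n).symm (t.realize (id : U n → U n)) =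
      r n (subst id (t.relabel Subtype.val)) := by
    intro n t
    rw [← realize_equiv]
    simp only [r]
    rw [realize_subst, Language.Term.realize_relabel]
    rfl
  let s : ℕ → ℕ := fun c => subst id (ofCode c)
  have hs : Computable s :=
    (computable_subst (v := fun _ : Unit => id) Computable.snd.to₂).comp (.const ()) .id
  have hD : ∀ n z, z ∈ diagramCodes (U n) ↔
      (IsTermCode (U n) z.unpair.2.unpair.1 ∧ IsTermCode (U n) z.unpair.2.unpair.2) ∧
      ((z.unpair.1 = 1 ∧ r n (s z.unpair.2.unpair.1) = r n (s z.unpair.2.unpair.2)) ∨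
        (z.unpair.1 = 0 ∧ ¬ r n (s z.unpair.2.unpair.1) = r n (s z.unpair.2.unpair.2))) := by
    intro n z
    rw [mem_diagramCodes_iff]
    constructor
    · rintro ⟨t, u, ht, hu, h⟩
      refine ⟨⟨⟨t, ht⟩, ⟨u, hu⟩⟩, ?_⟩
      simp only [s, ht, hu, ofCode_termCode, ← hE, (E n).symm.injective.eq_iff]
      exact h
    · rintro ⟨⟨⟨t, ht⟩, ⟨u, hu⟩⟩, h⟩
      refine ⟨t, u, ht, hu, ?_⟩
      simp only [s, ht, hu, ofCode_termCode, ← hE, (E n).symm.injective.eq_iff] at h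
      exact h
  have c1 : Computable fun p : ℕ × ℕ => p.2.unpair.2.unpair.1 :=
    computable_unpair_fst.comp (computable_unpair_snd.comp .snd)
  have c2 : Computable fun p : ℕ × ℕ => p.2.unpair.2.unpair.2 :=
    computable_unpair_snd.comp (computable_unpair_snd.comp .snd)
  have c0 : Computable fun p : ℕ × ℕ => p.2.unpair.1 := computable_unpair_fst.comp .snd
  have hT := computablePred_isTermCode hU
  have hr : ComputablePred fun p : ℕ × ℕ =>
      r p.1 (s p.2.unpair.2.unpair.1) = r p.1 (s p.2.unpair.2.unpair.2) :=
    computablePred_comp heq (Computable.fst.pair ((hs.comp c1).pair (hs.comp c2)))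
  have hcomp : ComputablePred fun p : ℕ × ℕ => p.2 ∈ diagramCodes (U p.1) := by
    refine ComputablePred.of_eq (computablePred_and
      (computablePred_and (computablePred_comp hT (Computable.fst.pair c1))
        (computablePred_comp hT (Computable.fst.pair c2)))
      (computablePred_or (computablePred_and (computablePred_eq c0 (.const 1)) hr)
        (computablePred_and (computablePred_eq c0 (.const 0)) hr.not))) fun p => (hD _ _).symm
  obtain ⟨h, hh, hchar⟩ := exists_index_isCharFun (D := fun n => diagramCodes (U n)) hcomp
  exact ⟨h, hh, fun n => ⟨U n, inst n, hchar n, ⟨(E n).symm⟩⟩⟩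

theorem IsCharFun.unique {f : ℕ →. ℕ} {D E : Set ℕ} (hD : IsCharFun f D) (hE : IsCharFun f E) :
    D = E := by
  ext n
  by_cases h1 : n ∈ D <;> by_cases h2 : n ∈ E <;> simp only [h1, h2]
  · exact absurd (Part.mem_unique ((hD n).1 h1) ((hE n).2 h2)) one_ne_zero
  · exact absurd (Part.mem_unique ((hE n).1 h2) ((hD n).2 h1)) one_ne_zero

/-- A characteristic function determines its set, and a diagram determines its structure, so an
index describes one isomorphism type only. -/
theorem mem_indexSet_iff {A C : Type*} [GroupLang.Structure A] [GroupLang.Structure C] {e : ℕ}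
    (h : ∃ (B : Set ℕ) (_ : GroupLang.Structure B),
      IsCharFun (phi e) (diagramCodes B) ∧ Nonempty (B ≃[GroupLang] C)) :
    e ∈ indexSet A ↔ Nonempty (C ≃[GroupLang] A) := by
  obtain ⟨B, _, hB, ⟨f⟩⟩ := h
  constructor
  · rintro ⟨B', _, hB', ⟨f'⟩⟩
    obtain ⟨g⟩ := equiv_of_diagramCodes_eq (hB.unique hB')
    exact ⟨(f'.comp g).comp f.symm⟩
  · rintro ⟨g⟩
    exact ⟨B, _, hB, ⟨g.comp f⟩⟩

/-! ### Words in the generators of a group -/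

theorem exists_realize_eq {G α : Type*} [Group G] (w : α → G) {g : G}
    (hg : g ∈ Subgroup.closure (Set.range w)) : ∃ t : GroupLang.Term α, t.realize w = g := by
  induction hg using Subgroup.closure_induction with
  | mem x hx =>
    obtain ⟨a, rfl⟩ := hx
    exact ⟨.var a, rfl⟩
  | one => exact ⟨tOne, by simp⟩
  | mul x y _ _ hx hy =>
    obtain ⟨t, rfl⟩ := hx
    obtain ⟨u, rfl⟩ := hy
    exact ⟨tMul t u, by simp⟩
  | inv x _ hx =>
    obtain ⟨t, rfl⟩ := hx
    exact ⟨tInv t, by simp⟩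

theorem realize_monoidHom {G H α : Type*} [Group G] [Group H] (f : G →* H) (w : α → G)
    (t : GroupLang.Term α) : t.realize (fun a => f (w a)) = f (t.realize w) := by
  induction t using term_induction <;> simp_all

theorem exists_list_closure_eq_top (G : Type*) [Group G] [Group.FG G] :
    ∃ l : List G, Subgroup.closure {g | g ∈ l} = ⊤ := by
  obtain ⟨S, hS⟩ := Group.fg_iff'.1 ‹Group.FG G›
  obtain ⟨T, -, hT⟩ := hS
  exact ⟨T.toList, by simpa using hT⟩

theorem equiv_iff_mulEquiv {G H : Type*} [Group G] [Group H] :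
    Nonempty (G ≃[GroupLang] H) ↔ Nonempty (G ≃* H) := by
  constructor
  · rintro ⟨e⟩
    refine ⟨⟨e.toEquiv, fun x y => ?_⟩⟩
    have := (realize_equiv e ![x, y] (tMul (.var 0) (.var 1))).symm
    simp only [realize_tMul, sMul_group] at this
    exact this
  · rintro ⟨e⟩
    refine ⟨⟨e.toEquiv, fun f x => ?_, fun r => r.elim⟩⟩
    cases f
    · exact map_one e
    · exact map_inv e _
    · exact map_mul e _ _

/-! ### Direct limits along powers of an endomorphism -/

theorem exists_directLimit_pow {G : Type u} [Group G] (f : Monoid.End G)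
    (hf : Function.Injective f) {c : ℕ → ℕ} (hc : Monotone c) :
    ∃ (A : Type u) (_ : Group A) (ι : ℕ → G →* A), (∀ s, Function.Injective (ι s)) ∧
      (∀ s t, s ≤ t → ∀ x, ι t ((f ^ (c t - c s)) x) = ι s x) ∧ ∀ a, ∃ s x, ι s x = a := by
  let F : ∀ i j : ℕ, i ≤ j → G →* G := fun i j _ => f ^ (c j - c i)
  have hsys : DirectedSystem (fun _ : ℕ => G) (F · · ·) :=
    ⟨fun i x => by
      simp only [F, Nat.sub_self, pow_zero]
      rfl, fun k j i hij hjk x => by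
      simp only [F]
      rw [← Nat.sub_add_sub_cancel (hc hjk) (hc hij), pow_add]
      rfl⟩
  let ι : ℕ → G →* DirectLimit (fun _ : ℕ => G) F := fun s =>
    { toFun := fun x => ⟦⟨s, x⟩⟧
      map_one' := (DirectLimit.one_def s).symm
      map_mul' := fun x y => (DirectLimit.mul_def (f := F) s x y).symm }
  refine ⟨DirectLimit (fun _ : ℕ => G) F, inferInstance, ι, ?_, ?_, ?_⟩
  · refine fun s => DirectLimit.mk_injective F (fun i j _ => ?_) s
    have h : Function.Injective (f ^ (c j - c i) : Monoid.End G) := by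
      rw [Monoid.End.coe_pow]
      exact hf.iterate _
    exact h
  · exact fun s t h x => DirectLimit.mk_apply (f := F) s t x h
  · intro a
    obtain ⟨s, x, rfl⟩ := DirectLimit.exists_eq_mk F a
    exact ⟨s, x, rfl⟩

section Limit

variable {G A : Type*} [Group G] [Group A] {f : Monoid.End G} {c : ℕ → ℕ} {ι : ℕ → G →* A}

/-- From stage `s₀` on the transition maps are `f ^ 0`, so nothing new enters the limit and `ι s₀`
is onto. -/
theorem nonempty_mulEquiv_of_eventually_const (hι : ∀ s, Function.Injective (ι s))
    (hcomp : ∀ s t, s ≤ t → ∀ x, ι t ((f ^ (c t - c s)) x) = ι s x)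
    (hsurj : ∀ a, ∃ s x, ι s x = a) {s₀ : ℕ} (hs : ∀ s, s₀ ≤ s → c s = c s₀) :
    Nonempty (A ≃* G) := by
  refine ⟨(MulEquiv.ofBijective (ι s₀) ⟨hι s₀, fun a => ?_⟩).symm⟩
  obtain ⟨s, x, rfl⟩ := hsurj a
  rcases le_total s s₀ with h | h
  · exact ⟨_, hcomp s s₀ h x⟩
  · refine ⟨x, ?_⟩
    have := hcomp s₀ s h x
    simpa [hs s h] using this.symm

/-- Were the limit isomorphic to `G`, its finitely many generators would lie in one stage `s`. At a
later `t` with `c s < c t`, injectivity of `ι t` would then make a positive power of `f`, and so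
`f`, surjective. -/
theorem not_nonempty_mulEquiv_of_unbounded [Group.FG G] (hf : ¬ Function.Surjective f)
    (hι : ∀ s, Function.Injective (ι s))
    (hcomp : ∀ s t, s ≤ t → ∀ x, ι t ((f ^ (c t - c s)) x) = ι s x)
    (hsurj : ∀ a, ∃ s x, ι s x = a) (hc : ∀ s, ∃ t, s ≤ t ∧ c s < c t) :
    ¬ Nonempty (A ≃* G) := by
  rintro ⟨e⟩
  have hmono : Monotone fun s => (ι s).range := by
    rintro s t h _ ⟨x, rfl⟩
    exact ⟨_, hcomp s t h x⟩
  obtain ⟨l, hl⟩ := exists_list_closure_eq_top G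
  have hbound : ∀ l : List G, ∃ s, ∀ g ∈ l, e.symm g ∈ (ι s).range := by
    intro l
    induction l with
    | nil => exact ⟨0, by simp⟩
    | cons g l ih =>
      obtain ⟨s, hs⟩ := ih
      obtain ⟨t, x, hx⟩ := hsurj (e.symm g)
      refine ⟨max s t, fun a ha => ?_⟩
      rcases List.mem_cons.1 ha with rfl | ha
      · exact hmono (le_max_right s t) ⟨x, hx⟩
      · exact hmono (le_max_left s t) (hs a ha)
  obtain ⟨s, hs⟩ := hbound l
  have htop : (⊤ : Subgroup G) ≤ (ι s).range.comap e.symm.toMonoidHom := by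
    rw [← hl, Subgroup.closure_le]
    exact hs
  obtain ⟨t, hst, hlt⟩ := hc s
  refine hf fun y => ?_
  obtain ⟨x, hx⟩ := htop (Subgroup.mem_top (e (ι t y)))
  have hx' : ι s x = ι t y := by simpa using hx
  rw [← hcomp s t hst] at hx'
  have := hι t hx'
  obtain ⟨k, hk⟩ := Nat.exists_eq_add_of_lt hlt
  have hk' : c t - c s = k + 1 := by omega
  -- Splits off the outermost factor `f`, exhibiting `y` as a value of `f`.
  rw [hk', pow_succ'] at this
  exact ⟨_, this⟩

end Limit

/-! ### Counting the witnesses that fail -/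

section Search

variable (R : ℕ → ℕ → Bool)

/-- The state of the search for `x` with `R x y` for all `y`: the current candidate `x`, and the
next `y` to try. -/
def searchState : ℕ → ℕ × ℕ :=
  Nat.rec (0, 0) fun _ q => if R q.1 q.2 then (q.1, q.2 + 1) else (q.1 + 1, 0)

theorem searchState_succ (s : ℕ) : searchState R (s + 1) =
    if R (searchState R s).1 (searchState R s).2 then
      ((searchState R s).1, (searchState R s).2 + 1) else ((searchState R s).1 + 1, 0) := rfl

theorem monotone_searchState : Monotone fun s => (searchState R s).1 :=
  monotone_nat_of_le_succ fun s => by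
    rw [searchState_succ]
    split_ifs <;> simp

theorem searchState_invariant (s : ℕ) :
    ∀ y < (searchState R s).2, R (searchState R s).1 y := by
  induction s with
  | zero => exact fun y hy => absurd hy (Nat.not_lt_zero y)
  | succ s ih =>
    rw [searchState_succ]
    split_ifs with h
    · intro y hy
      rcases Nat.lt_succ_iff_lt_or_eq.1 hy with hy | rfl
      · exact ih y hy
      · exact h
    · exact fun y hy => absurd hy (Nat.not_lt_zero y)

/-- The candidate never moves past a true witness, so it is bounded and, being monotone, stabilizes.
Conversely, a candidate that is never abandoned gets tested on every `y`. -/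
theorem exists_forall_iff_searchState : (∃ x, ∀ y, R x y) ↔
    ∃ s₀, ∀ s, s₀ ≤ s → (searchState R s).1 = (searchState R s₀).1 := by
  constructor
  · rintro ⟨x, hx⟩
    have hle : ∀ s, (searchState R s).1 ≤ x := by
      intro s
      induction s with
      | zero => exact Nat.zero_le x
      | succ s ih =>
        rw [searchState_succ]
        split_ifs with h
        · exact ih
        · refine Nat.succ_le_of_lt (lt_of_le_of_ne ih ?_)
          rintro he
          exact h (he ▸ hx _)
    by_contra! hno
    have hbig : ∀ k, ∃ s, k ≤ (searchState R s).1 := by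
      intro k
      induction k with
      | zero => exact ⟨0, Nat.zero_le _⟩
      | succ k ih =>
        obtain ⟨s, hs⟩ := ih
        obtain ⟨t, hst, ht⟩ := hno s
        have := monotone_searchState R hst
        simp only at this
        exact ⟨t, by omega⟩
    obtain ⟨s, hs⟩ := hbig (x + 1)
    have := hle s
    omega
  · rintro ⟨s₀, h₀⟩
    have hstep : ∀ j, (searchState R (s₀ + j)).1 = (searchState R s₀).1 ∧
        j ≤ (searchState R (s₀ + j)).2 := by
      intro j
      refine ⟨h₀ _ (Nat.le_add_right _ _), ?_⟩
      induction j with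
      | zero => exact Nat.zero_le _
      | succ j ih =>
        have h1 := h₀ (s₀ + j) (Nat.le_add_right _ _)
        have h2 := h₀ (s₀ + j + 1) (by omega)
        rw [← Nat.add_assoc]
        rw [searchState_succ] at h2 ⊢
        split_ifs at h2 ⊢ with h
        · exact Nat.succ_le_succ ih
        · simp only at h2; omega
    refine ⟨(searchState R s₀).1, fun y => ?_⟩
    obtain ⟨h1, h2⟩ := hstep (y + 1)
    rw [← h1]
    exact searchState_invariant R _ y h2

end Search

theorem computable_searchState {R : ℕ × ℕ × ℕ → Bool} (hR : Computable R) :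
    Computable fun p : ℕ × ℕ => (searchState (fun x y => R (p.1, x, y)) p.2).1 := by
  have hx : Computable fun p : (ℕ × ℕ) × ℕ × ℕ × ℕ => p.2.2.1 :=
    Computable.fst.comp (Computable.snd.comp .snd)
  have hy : Computable fun p : (ℕ × ℕ) × ℕ × ℕ × ℕ => p.2.2.2 :=
    Computable.snd.comp (Computable.snd.comp .snd)
  have hn : Computable fun p : (ℕ × ℕ) × ℕ × ℕ × ℕ => p.1.1 := Computable.fst.comp .fst
  have hd : Computable fun p : (ℕ × ℕ) × ℕ × ℕ × ℕ => R (p.1.1, p.2.2.1, p.2.2.2) :=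
    hR.comp (hn.pair (hx.pair hy))
  have hstep : Computable fun p : (ℕ × ℕ) × ℕ × ℕ × ℕ =>
      bif R (p.1.1, p.2.2.1, p.2.2.2) then (p.2.2.1, p.2.2.2 + 1) else (p.2.2.1 + 1, 0) :=
    Computable.cond hd (hx.pair (Computable.succ.comp hy))
      ((Computable.succ.comp hx).pair (.const 0))
  have hstate : Computable fun p : ℕ × ℕ => searchState (fun x y => R (p.1, x, y)) p.2 := by
    refine (Computable.nat_rec (f := fun p : ℕ × ℕ => p.2) .snd (.const ((0, 0) : ℕ × ℕ))
      hstep.to₂).of_eq fun p => ?_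
    obtain ⟨n, s⟩ := p
    induction s with
    | zero => rfl
    | succ s ih =>
      simp only at ih ⊢
      rw [ih, searchState_succ, Bool.cond_eq_ite]
  exact Computable.fst.comp hstate

/-! ### Groups that are not co-Hopfian -/

theorem exists_injective_not_surjective {G : Type*} [Group G] (hG : ¬ IsCoHopfian G) :
    ∃ f : Monoid.End G, Function.Injective f ∧ ¬ Function.Surjective f := by
  simp only [IsCoHopfian, not_forall] at hG
  obtain ⟨H, ⟨e⟩, hH⟩ := hG
  refine ⟨H.subtype.comp e.symm.toMonoidHom, ?_, fun hs => hH ?_⟩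
  · exact H.subtype_injective.comp e.symm.injective
  · rw [eq_top_iff]
    intro g _
    obtain ⟨x, rfl⟩ := hs g
    exact (e.symm x).2

theorem computable_iterate {F : ℕ → ℕ} (hF : Computable F) : Computable₂ fun k x => F^[k] x := by
  refine (Computable.nat_rec (f := fun p : ℕ × ℕ => p.1) (g := fun p => p.2)
    (h := fun _ q => F q.2) .fst .snd
    (hF.comp (Computable.snd.comp .snd)).to₂).of_eq fun p => ?_
  obtain ⟨k, x⟩ := p
  induction k with
  | zero => rfl
  | succ k ih =>
    simp only at ih ⊢
    rw [ih, Function.iterate_succ_apply']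

theorem isSigmaTwoHard_of_not_isCoHopfian {G : Type u} [Group G] [Group.FG G]
    (hG : IsComputableStructure G) (hco : ¬ IsCoHopfian G) : IsSigmaTwoHard (indexSet G) := by
  classical
  rintro S ⟨R, hR, hS⟩
  obtain ⟨f, hfi, hfs⟩ := exists_injective_not_surjective hco
  obtain ⟨l, hl⟩ := exists_list_closure_eq_top G
  let γ : ℕ → G := fun i => l[i]?.getD 1
  have hγ : ∀ g, ∃ t : GroupLang.Term ℕ, t.realize γ = g := by
    intro g
    refine exists_realize_eq γ ?_
    have : Subgroup.closure {g | g ∈ l} ≤ Subgroup.closure (Set.range γ) := by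
      refine Subgroup.closure_mono fun x hx => ?_
      obtain ⟨i, hi, rfl⟩ := List.getElem_of_mem hx
      exact ⟨i, by simp [γ, hi]⟩
    exact this (hl ▸ Subgroup.mem_top g)
  let ρ : ℕ → G := fun c => (ofCode c).realize γ
  have hρ : ComputablePred fun p : ℕ × ℕ => ρ p.1 = ρ p.2 := computablePred_realize_eq hG l 1
  choose W hW using fun g => hγ (f g)
  -- A finite table of words for the images of the generators; the default codes `1`, the image
  -- under `f` of the padding value of `γ`.
  let V : ℕ → ℕ := fun i => (l.map fun g => termCode (W g))[i]?.getD (Nat.pair 1 0)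
  have hVρ : ∀ i, ρ (V i) = f (γ i) := by
    intro i
    simp only [ρ, V, γ, List.getElem?_map]
    cases l[i]? with
    | none => simp
    | some g => simpa using hW g
  let F : ℕ → ℕ := fun c => subst V (ofCode c)
  have hF : Computable F := (computable_subst (v := fun _ : Unit => V)
    ((computable_list_lookup _ _).comp .snd).to₂).comp (.const ()) .id
  have hFρ : ∀ c, ρ (F c) = f (ρ c) := by
    intro c
    simp only [ρ, F]
    rw [realize_subst]
    refine Eq.trans ?_ (realize_monoidHom f γ (ofCode c))
    congr 1
    funext i
    exact hVρ i
  have hFiter : ∀ k c, ρ (F^[k] c) = (f ^ k) (ρ c) := by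
    intro k c
    rw [Monoid.End.coe_pow]
    induction k generalizing c with
    | zero => rfl
    | succ k ih => rw [Function.iterate_succ_apply, Function.iterate_succ_apply, ih, hFρ]
  let Q : ℕ → ℕ → ℕ → Bool := fun n x y => decide (R (n, x, y))
  let c : ℕ → ℕ → ℕ := fun n s => (searchState (Q n) s).1
  have hc : Computable₂ c := computable_searchState hR.decide
  have hmono : ∀ n, Monotone (c n) := fun n => monotone_searchState (Q n)
  choose A iA ι hι hcomp hsurj using fun n => exists_directLimit_pow f hfi (hmono n)
  -- The variable `Nat.pair s i` names the `i`-th generator of the copy of `G` at stage `s`.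
  let w : ∀ n, ℕ → A n := fun n m => ι n m.unpair.1 (γ m.unpair.2)
  -- A word for the same generator moved to stage `N`, obtained by iterating the action `F` of `f`
  -- on codes.
  let T : ℕ → ℕ → ℕ → ℕ := fun n N m =>
    F^[c n N - c n m.unpair.1] (Nat.pair 0 m.unpair.2)
  -- A code bounds the stages of all variables in its term, so `d ≤ N` ensures that every generator
  -- can be moved forward to stage `N`. Induction on the code keeps this bound available.
  have hT : ∀ n N d, d ≤ N →
      (ofCode d).realize (w n) = ι n N (ρ (subst (T n N) (ofCode d))) := by
    intro n N d
    induction d using ofCode.induct with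
    | case1 d h0 =>
      intro hd
      rw [ofCode, if_pos h0]
      have hm : d.unpair.2.unpair.1 ≤ N :=
        (Nat.unpair_left_le _).trans ((Nat.unpair_right_le _).trans hd)
      simp only [subst, foldTerm_var, T, hFiter, Language.Term.realize, w]
      rw [← hcomp n _ N hm]
      simp [ρ]
    | case2 d h0 h2 ih =>
      intro hd
      rw [ofCode, if_neg h0, dif_pos h2, realize_tInv, ih ((Nat.unpair_right_le _).trans hd)]
      simp [subst, ρ]
    | case3 d h0 h2 h3 ih1 ih2 =>
      intro hd
      have hr := (Nat.unpair_right_le d).trans hd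
      rw [ofCode, if_neg h0, dif_neg h2, dif_pos h3, realize_tMul,
        ih1 ((Nat.unpair_left_le _).trans hr), ih2 ((Nat.unpair_right_le _).trans hr)]
      simp [subst, ρ]
    | case4 d h0 h2 h3 =>
      intro hd
      rw [ofCode, if_neg h0, dif_neg h2, dif_neg h3]
      simp [subst, ρ]
  have hTcomp : Computable fun p : (ℕ × ℕ) × ℕ => subst (T p.1.1 p.1.2) (ofCode p.2) := by
    refine computable_subst (v := fun p : ℕ × ℕ => T p.1 p.2) ?_
    have h1 : Computable fun p : (ℕ × ℕ) × ℕ => p.1.1 := Computable.fst.comp .fst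
    refine (computable_iterate hF).comp (Primrec.nat_sub.to_comp.comp
      (hc.comp h1 (Computable.snd.comp .fst))
      (hc.comp h1 (computable_unpair_fst.comp .snd)))
      ((Primrec₂.natPair.to_comp : Computable₂ Nat.pair).comp (.const 0)
        (computable_unpair_snd.comp .snd))
  have heq : ComputablePred fun p : ℕ × ℕ × ℕ =>
      (ofCode p.2.1).realize (w p.1) = (ofCode p.2.2).realize (w p.1) := by
    have hd : Computable fun p : ℕ × ℕ × ℕ => p.2.1 := Computable.fst.comp .snd
    have hd' : Computable fun p : ℕ × ℕ × ℕ => p.2.2 := Computable.snd.comp .snd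
    -- The sum of the two codes is a stage late enough for both terms.
    have hN : Computable fun p : ℕ × ℕ × ℕ => (p.1, p.2.1 + p.2.2) :=
      Computable.fst.pair (Primrec.nat_add.to_comp.comp hd hd')
    refine (computablePred_comp hρ ((hTcomp.comp (hN.pair hd)).pair
      (hTcomp.comp (hN.pair hd')))).of_eq fun p => ?_
    rw [hT p.1 (p.2.1 + p.2.2) p.2.1 (Nat.le_add_right _ _),
      hT p.1 (p.2.1 + p.2.2) p.2.2 (Nat.le_add_left _ _), (hι _ _).eq_iff]
  have hw : ∀ n a, ∃ t : GroupLang.Term ℕ, t.realize (w n) = a := by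
    intro n a
    obtain ⟨s, x, rfl⟩ := hsurj n a
    obtain ⟨t, rfl⟩ := hγ x
    refine ⟨t.relabel (Nat.pair s), ?_⟩
    rw [Language.Term.realize_relabel, ← realize_monoidHom]
    congr 1
    funext i
    simp [w]
  obtain ⟨h, hh, hidx⟩ := exists_computable_index w hw heq
  refine ⟨h, hh, fun n => ?_⟩
  change n ∈ S ↔ h n ∈ indexSet G
  have hSQ : (∃ x, ∀ y, R (n, x, y)) ↔ ∃ x, ∀ y, Q n x y = true := by simp [Q]
  rw [mem_indexSet_iff (hidx n), equiv_iff_mulEquiv, hS n, hSQ,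
    exists_forall_iff_searchState (Q n)]
  constructor
  · rintro ⟨s₀, hs₀⟩
    exact nonempty_mulEquiv_of_eventually_const (hι n) (hcomp n) (hsurj n) hs₀
  · intro he
    by_contra! hno
    refine not_nonempty_mulEquiv_of_unbounded hfs (hι n) (hcomp n) (hsurj n) (fun s => ?_) he
    obtain ⟨t, hst, ht⟩ := hno s
    exact ⟨t, hst, lt_of_le_of_ne (hmono n hst) (Ne.symm ht)⟩

/-! ### Structures generated by tuples of the same atomic type -/

/-- The tuples `v` and `w` have the same atomic type. -/
def SameAtomicType {α M N : Type*} [GroupLang.Structure M] [GroupLang.Structure N]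
    (v : α → M) (w : α → N) : Prop :=
  ∀ t u : GroupLang.Term α, t.realize v = u.realize v ↔ t.realize w = u.realize w

/-- Send the value of a term at `v` to its value at `w`; equality of types makes this well defined
and injective. No group axioms enter, so it applies to arbitrary models of the Scott sentence. -/
theorem SameAtomicType.nonempty_equiv {α M N : Type*} [GroupLang.Structure M]
    [GroupLang.Structure N] {v : α → M} {w : α → N} (h : SameAtomicType v w)
    (hv : ∀ a, ∃ t : GroupLang.Term α, t.realize v = a)
    (hw : ∀ a, ∃ t : GroupLang.Term α, t.realize w = a) : Nonempty (M ≃[GroupLang] N) := by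
  choose T hT using hv
  have hTw : ∀ t : GroupLang.Term α, (T (t.realize v)).realize w = t.realize w := fun t =>
    (h _ _).1 (hT _)
  refine ⟨⟨Equiv.ofBijective (fun a => (T a).realize w) ⟨fun a b hab => ?_, fun b => ?_⟩,
    fun {n} f x => ?_, fun r => r.elim⟩⟩
  · rw [← hT a, ← hT b]
    exact (h _ _).2 hab
  · obtain ⟨t, rfl⟩ := hw b
    exact ⟨t.realize v, hTw t⟩
  · have := hTw (.func f fun i => T (x i))
    simp only [Language.Term.realize, hT] at this
    exact this

theorem sameAtomicType_equiv {α M N : Type*} [GroupLang.Structure M] [GroupLang.Structure N]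
    (e : M ≃[GroupLang] N) (v : α → M) : SameAtomicType v fun a => e (v a) := by
  intro t u
  rw [realize_equiv, realize_equiv, e.injective.eq_iff]

theorem SameAtomicType.trans {α M N K : Type*} [GroupLang.Structure M] [GroupLang.Structure N]
    [GroupLang.Structure K] {u : α → M} {v : α → N} {w : α → K} (h : SameAtomicType u v)
    (h' : SameAtomicType v w) : SameAtomicType u w := fun s t => (h s t).trans (h' s t)

theorem SameAtomicType.symm {α M N : Type*} [GroupLang.Structure M] [GroupLang.Structure N]
    {v : α → M} {w : α → N} (h : SameAtomicType v w) : SameAtomicType w v :=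
  fun s t => (h s t).symm

/-- The subgroup generated by `v` is isomorphic to `G`, because `v` has the type of a generating
tuple; co-Hopficity makes it all of `G`. -/
theorem IsCoHopfian.exists_realize_eq {G α : Type*} [Group G] (hG : IsCoHopfian G) {v w : α → G}
    (h : SameAtomicType v w) (hw : ∀ a, ∃ t : GroupLang.Term α, t.realize w = a) (g : G) :
    ∃ t : GroupLang.Term α, t.realize v = g := by
  let H := Subgroup.closure (Set.range v)
  let v' : α → H := fun a => ⟨v a, Subgroup.subset_closure ⟨a, rfl⟩⟩
  have hv' : ∀ t : GroupLang.Term α, ((t.realize v' : H) : G) = t.realize v := fun t =>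
    (realize_monoidHom H.subtype v' t).symm
  have hgen : ∀ a : H, ∃ t : GroupLang.Term α, t.realize v' = a := by
    rintro ⟨a, ha⟩
    obtain ⟨t, ht⟩ := CompGroup.exists_realize_eq v ha
    exact ⟨t, Subtype.ext ((hv' t).trans ht)⟩
  have hsame : SameAtomicType v' w := fun t u => by
    rw [← h t u, ← hv', ← hv', Subtype.ext_iff]
  have htop := hG H (equiv_iff_mulEquiv.1 (hsame.nonempty_equiv hgen hw))
  exact CompGroup.exists_realize_eq v (htop ▸ Subgroup.mem_top g : g ∈ H)

namespace InfFormula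

/-! ### Quantification over finite tuples -/

section Quantifiers

variable {M : Type*} [GroupLang.Structure M] (x : List ℕ) (φ : InfFormula)

theorem realize_exs (v : ℕ → M) :
    (exs x φ).Realize v ↔ ∃ v' : ℕ → M, (∀ i ∉ x, v' i = v i) ∧ φ.Realize v' := by
  induction x generalizing v with
  | nil =>
    refine ⟨fun h => ⟨v, fun _ _ => rfl, h⟩, ?_⟩
    rintro ⟨v', h, hφ⟩
    rwa [show v' = v from funext fun i => h i List.not_mem_nil] at hφ
  | cons j x ih =>
    change (∃ a, (exs x φ).Realize (Function.update v j a)) ↔ _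
    simp only [ih]
    constructor
    · rintro ⟨a, v', h, hφ⟩
      refine ⟨v', fun i hi => ?_, hφ⟩
      rw [List.mem_cons, not_or] at hi
      rw [h i hi.2, Function.update_of_ne hi.1]
    · rintro ⟨v', h, hφ⟩
      refine ⟨v' j, v', fun i hi => ?_, hφ⟩
      rcases eq_or_ne i j with rfl | hij
      · simp
      · rw [Function.update_of_ne hij]
        exact h i (by simp [hij, hi])

theorem realize_alls (v : ℕ → M) :
    (alls x φ).Realize v ↔ ∀ v' : ℕ → M, (∀ i ∉ x, v' i = v i) → φ.Realize v' := by
  induction x generalizing v with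
  | nil =>
    refine ⟨fun h v' hv => ?_, fun h => h v fun _ _ => rfl⟩
    rwa [show v' = v from funext fun i => hv i List.not_mem_nil]
  | cons j x ih =>
    change (∀ a, (alls x φ).Realize (Function.update v j a)) ↔ _
    simp only [ih]
    constructor
    · intro h v' hv
      refine h (v' j) v' fun i hi => ?_
      rcases eq_or_ne i j with rfl | hij
      · simp
      · rw [Function.update_of_ne hij]
        exact hv i (by simp [hij, hi])
    · intro h a v' hv
      refine h v' fun i hi => ?_
      rw [List.mem_cons, not_or] at hi
      rw [hv i hi.2, Function.update_of_ne hi.1]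

theorem freeVars_exs : (exs x φ).freeVars = φ.freeVars \ {i | i ∈ x} := by
  induction x with
  | nil => simp [exs]
  | cons j x ih =>
    change (exs x φ).freeVars \ {j} = _
    rw [ih]
    ext i
    simp [and_assoc, and_comm]

theorem freeVars_alls : (alls x φ).freeVars = φ.freeVars \ {i | i ∈ x} := by
  induction x with
  | nil => simp [alls]
  | cons j x ih =>
    change (alls x φ).freeVars \ {j} = _
    rw [ih]
    ext i
    simp [and_assoc, and_comm]

theorem IsComputable.exs {φ : InfFormula} (h : φ.IsComputable) (x : List ℕ) :
    (exs x φ).IsComputable := by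
  induction x with
  | nil => exact h
  | cons j x ih =>
    obtain ⟨c, hc⟩ := ih
    exact ⟨_, .ex j hc⟩

theorem IsComputable.alls {φ : InfFormula} (h : φ.IsComputable) (x : List ℕ) :
    (alls x φ).IsComputable := by
  induction x with
  | nil => exact h
  | cons j x ih =>
    obtain ⟨c, hc⟩ := ih
    exact ⟨_, .all j hc⟩

end Quantifiers

/-! ### Computable infinite conjunctions and disjunctions -/

theorem exists_ceSet_singleton (c : ℕ) : ∃ e, ceSet e = {c} :=
  exists_ceSet_eq (computablePred_eq Computable.id (.const c))

/-- The index set of a computable conjunction must consist of codes of its conjuncts, so the single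
index has to be a code of `φ`. -/
theorem IsComputable.conj_singleton {φ : InfFormula} (h : φ.IsComputable) :
    ∃ c : ℕ, (conj {c} fun _ => φ).IsComputable := by
  obtain ⟨c, hc⟩ := h
  obtain ⟨e, he⟩ := exists_ceSet_singleton c
  refine ⟨c, Nat.pair 6 e, ?_⟩
  rw [← he]
  refine .conj e fun w => ?_
  have hw : (w : ℕ) = c := by simpa [he] using w.2
  rwa [hw]

theorem IsComputable.disj_singleton {φ : InfFormula} (h : φ.IsComputable) :
    ∃ c : ℕ, (disj {c} fun _ => φ).IsComputable := by
  obtain ⟨c, hc⟩ := h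
  obtain ⟨e, he⟩ := exists_ceSet_singleton c
  refine ⟨c, Nat.pair 7 e, ?_⟩
  rw [← he]
  refine .disj e fun w => ?_
  have hw : (w : ℕ) = c := by simpa [he] using w.2
  rwa [hw]

/-- The equality `t = u` if `b` is true, and its negation otherwise. -/
def literal (b : Bool) (t u : GroupLang.Term ℕ) : InfFormula :=
  if b then equal t u else neg (equal t u)

theorem isQF_literal (b : Bool) (t u : GroupLang.Term ℕ) : IsQF (literal b t u) := by
  cases b
  · exact .neg (.equal t u)
  · exact .equal t u

theorem realize_literal {M : Type*} [GroupLang.Structure M] (b : Bool)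
    (t u : GroupLang.Term ℕ) (v : ℕ → M) :
    (literal b t u).Realize v ↔ (b = true ↔ t.realize v = u.realize v) := by
  cases b <;> simp [literal, Realize]

theorem freeVars_literal (b : Bool) (t u : GroupLang.Term ℕ) :
    (literal b t u).freeVars = ↑t.varFinset ∪ ↑u.varFinset := by
  cases b <;> rfl

/-- Turns a decidable set of literals into a c.e. set of their Gödel numbers. Canonical term codes
are required because `HasCode` accepts no others. -/
theorem exists_code_literals {P : Bool × ℕ × ℕ → Prop} (hP : ComputablePred P)
    (hcode : ∀ b c d, P (b, c, d) → termCode (ofCode c) = c ∧ termCode (ofCode d) = d) :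
    ∃ (e : ℕ) (φ : ceSet e → InfFormula), (∀ w : ceSet e, HasCode w (φ w)) ∧
      (∀ w, ∃ b t u, P (b, termCode t, termCode u) ∧ φ w = literal b t u) ∧
      ∀ b t u, P (b, termCode t, termCode u) → ∃ w, φ w = literal b t u := by
  -- The tags follow `HasCode`: `0` for an equation, `1` followed by `0` for a negated one.
  let W : Set ℕ := {z | (z.unpair.1 = 0 ∧ P (true, z.unpair.2.unpair.1, z.unpair.2.unpair.2)) ∨
    ((z.unpair.1 = 1 ∧ z.unpair.2.unpair.1 = 0) ∧
      P (false, z.unpair.2.unpair.2.unpair.1, z.unpair.2.unpair.2.unpair.2))}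
  have h21 := computable_unpair_fst.comp computable_unpair_snd
  have h22 := computable_unpair_snd.comp computable_unpair_snd
  have hW : ComputablePred (· ∈ W) := computablePred_or
    (computablePred_and (computablePred_eq computable_unpair_fst (.const 0))
      (computablePred_comp hP ((Computable.const true).pair (h21.pair h22))))
    (computablePred_and
      (computablePred_and (computablePred_eq computable_unpair_fst (.const 1))
        (computablePred_eq h21 (.const 0)))
      (computablePred_comp hP ((Computable.const false).pair
        ((computable_unpair_fst.comp h22).pair (computable_unpair_snd.comp h22)))))
  obtain ⟨e, he⟩ := exists_ceSet_eq hW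
  let ψ : ℕ → InfFormula := fun z =>
    if z.unpair.1 = 0 then literal true (ofCode z.unpair.2.unpair.1) (ofCode z.unpair.2.unpair.2)
    else literal false (ofCode z.unpair.2.unpair.2.unpair.1)
      (ofCode z.unpair.2.unpair.2.unpair.2)
  refine ⟨e, fun w => ψ w, ?_, ?_, ?_⟩
  · rintro ⟨z, hz⟩
    rw [he] at hz
    rcases hz with ⟨h0, hz⟩ | ⟨⟨h1, h0⟩, hz⟩
    · obtain ⟨hc, hd⟩ := hcode _ _ _ hz
      have := HasCode.equal (ofCode z.unpair.2.unpair.1) (ofCode z.unpair.2.unpair.2)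
      rw [hc, hd, Nat.pair_unpair, ← h0, Nat.pair_unpair] at this
      simpa [ψ, h0, literal] using this
    · obtain ⟨hc, hd⟩ := hcode _ _ _ hz
      have := HasCode.neg (HasCode.equal (ofCode z.unpair.2.unpair.2.unpair.1)
        (ofCode z.unpair.2.unpair.2.unpair.2))
      rw [hc, hd, Nat.pair_unpair, ← h0, Nat.pair_unpair, ← h1, Nat.pair_unpair] at this
      simpa [ψ, h1, literal] using this
  · rintro ⟨z, hz⟩
    rw [he] at hz
    rcases hz with ⟨h0, hz⟩ | ⟨⟨h1, -⟩, hz⟩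
    · obtain ⟨hc, hd⟩ := hcode _ _ _ hz
      exact ⟨true, ofCode z.unpair.2.unpair.1, ofCode z.unpair.2.unpair.2, by rwa [hc, hd],
        by simp [ψ, h0]⟩
    · obtain ⟨hc, hd⟩ := hcode _ _ _ hz
      exact ⟨false, ofCode z.unpair.2.unpair.2.unpair.1,
        ofCode z.unpair.2.unpair.2.unpair.2, by rwa [hc, hd], by simp [ψ, h1]⟩
  · intro b t u h
    cases b
    · refine ⟨⟨Nat.pair 1 (Nat.pair 0 (Nat.pair (termCode t) (termCode u))), ?_⟩, ?_⟩
      · rw [he]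
        exact Or.inr (by simpa using h)
      · simp [ψ]
    · refine ⟨⟨Nat.pair 0 (Nat.pair (termCode t) (termCode u)), ?_⟩, ?_⟩
      · rw [he]
        exact Or.inl (by simpa using h)
      · simp [ψ]

/-! ### Co-Hopfian groups -/

section CoHopfian

variable {G : Type u} [Group G] (k : ℕ) (γ : ℕ → G)

/-- The tuple of the first `k` entries of a sequence. -/
def initial {M : Type*} (k : ℕ) (v : ℕ → M) : Set.Iio k → M := fun i => v i

theorem realize_relabel_val {M : Type*} [GroupLang.Structure M] (v : ℕ → M)
    (t : GroupLang.Term (Set.Iio k)) :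
    (t.relabel Subtype.val).realize v = t.realize (initial k v) := by
  rw [Language.Term.realize_relabel]
  rfl

theorem computablePred_isTermCode_Iio : ComputablePred (IsTermCode (Set.Iio k)) := by
  have h : ComputablePred fun p : Unit × ℕ => p.2 ∈ Set.Iio k :=
    computablePred_comp (p := fun x : ℕ × ℕ => x.1 < x.2)
      (PrimrecPred.computablePred Primrec.nat_lt) (Computable.snd.pair (.const k))
  exact computablePred_comp (computablePred_isTermCode (U := fun _ : Unit => Set.Iio k) h)
    ((Computable.const ()).pair .id)

theorem computablePred_fst_eq {α : Type*} [Primcodable α] (b : Bool) :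
    ComputablePred fun p : Bool × α => p.1 = b :=
  computablePred_comp (p := fun x : Bool × Bool => x.1 = x.2)
    (PrimrecPred.computablePred (Primrec.eq (α := Bool))) (Computable.fst.pair (.const b))

/-- The code `(b, c, d)` of a literal in the first `k` variables. -/
def IsLiteralCode (p : Bool × ℕ × ℕ) : Prop :=
  IsTermCode (Set.Iio k) p.2.1 ∧ IsTermCode (Set.Iio k) p.2.2

/-- The literal with code `(b, c, d)` holds of the sequence `γ`. -/
def HoldsAt (p : Bool × ℕ × ℕ) : Prop :=
  (p.1 = true ∧ (ofCode p.2.1).realize γ = (ofCode p.2.2).realize γ) ∨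
    (p.1 = false ∧ ¬ (ofCode p.2.1).realize γ = (ofCode p.2.2).realize γ)

variable {γ} in
theorem holdsAt_iff (b : Bool) (t u : GroupLang.Term ℕ) :
    HoldsAt γ (b, termCode t, termCode u) ↔ (b = true ↔ t.realize γ = u.realize γ) := by
  cases b <;> simp [HoldsAt]

theorem computablePred_isLiteralCode : ComputablePred (IsLiteralCode k) :=
  computablePred_and
    (computablePred_comp (computablePred_isTermCode_Iio k) (Computable.fst.comp .snd))
    (computablePred_comp (computablePred_isTermCode_Iio k) (Computable.snd.comp .snd))

variable {γ} in
theorem computablePred_holdsAt (hγ : ComputablePred fun p : ℕ × ℕ =>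
      (ofCode p.1).realize γ = (ofCode p.2).realize γ) :
    ComputablePred (HoldsAt γ) := by
  have h := computablePred_comp hγ (Computable.snd (α := Bool) (β := ℕ × ℕ))
  exact computablePred_or (computablePred_and (computablePred_fst_eq true) h)
    (computablePred_and (computablePred_fst_eq false) h.not)

theorem termCode_ofCode_of_isTermCode {U : Set ℕ} {c : ℕ} (h : IsTermCode U c) :
    termCode (ofCode c) = c := (isTermCode_iff.1 h).1

theorem isTermCode_termCode {U : Set ℕ} {t : GroupLang.Term ℕ} :
    IsTermCode U (termCode t) ↔ ∃ s : GroupLang.Term U, t = s.relabel Subtype.val := by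
  simp only [IsTermCode, termCode_injective.eq_iff]

/-- The atomic type of `γ 0, …, γ (k - 1)` is defined by a computable `Π₁` formula. -/
theorem exists_isPi_one_atomicType (hγ : ComputablePred fun p : ℕ × ℕ =>
      (ofCode p.1).realize γ = (ofCode p.2).realize γ) :
    ∃ φ : InfFormula, φ.IsComputable ∧ IsPi 1 φ ∧ φ.freeVars ⊆ Set.Iio k ∧
      ∀ (M : Type u) [GroupLang.Structure M] (v : ℕ → M),
        φ.Realize v ↔ SameAtomicType (initial k v) (initial k γ) := by
  have hP := computablePred_and (computablePred_isLiteralCode k) (computablePred_holdsAt hγ)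
  obtain ⟨e, φ, hφ, hlit, hall⟩ := exists_code_literals hP fun b c d h =>
    ⟨termCode_ofCode_of_isTermCode h.1.1, termCode_ofCode_of_isTermCode h.1.2⟩
  refine ⟨conj (ceSet e) φ, ⟨_, .conj e hφ⟩,
    .conj (ceSet e) (fun _ => []) (fun _ => 0) φ (fun _ => Nat.one_pos) fun w => ?_, ?_, ?_⟩
  · obtain ⟨b, t, u, -, h⟩ := hlit w
    exact h ▸ .qf (isQF_literal b t u)
  · refine Set.iUnion_subset fun w => ?_
    obtain ⟨b, t, u, ⟨⟨ht, hu⟩, -⟩, h⟩ := hlit w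
    obtain ⟨t, rfl⟩ := isTermCode_termCode.1 ht
    obtain ⟨u, rfl⟩ := isTermCode_termCode.1 hu
    rw [h, freeVars_literal]
    exact Set.union_subset (varFinset_relabel_val t) (varFinset_relabel_val u)
  · intro M _ v
    constructor
    · intro h t u
      let b : Bool := @decide (t.realize (initial k γ) = u.realize (initial k γ))
        (Classical.propDecidable _)
      obtain ⟨w, hw⟩ := hall b (t.relabel Subtype.val) (u.relabel Subtype.val)
        ⟨⟨⟨t, rfl⟩, ⟨u, rfl⟩⟩, by
          rw [holdsAt_iff, realize_relabel_val, realize_relabel_val]; simp [b]⟩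
      have := h w
      rw [hw, realize_literal, realize_relabel_val, realize_relabel_val] at this
      rw [← this]
      simp [b]
    · intro h w
      obtain ⟨b, t, u, ⟨⟨ht, hu⟩, hb⟩, hw⟩ := hlit w
      obtain ⟨t, rfl⟩ := isTermCode_termCode.1 ht
      obtain ⟨u, rfl⟩ := isTermCode_termCode.1 hu
      rw [holdsAt_iff, realize_relabel_val, realize_relabel_val] at hb
      rw [hw, realize_literal, realize_relabel_val, realize_relabel_val, hb, h]

/-- There is a computable `Σ₁` formula saying that `x_k` is generated by `x_0, …, x_{k-1}` if
these have the atomic type of `γ 0, …, γ (k - 1)`. -/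
theorem exists_isSigma_one_generates (hγ : ComputablePred fun p : ℕ × ℕ =>
      (ofCode p.1).realize γ = (ofCode p.2).realize γ) :
    ∃ φ : InfFormula, φ.IsComputable ∧ IsSigma 1 φ ∧ φ.freeVars ⊆ Set.Iio (k + 1) ∧
      ∀ (M : Type u) [GroupLang.Structure M] (v : ℕ → M),
        φ.Realize v ↔ (SameAtomicType (initial k v) (initial k γ) →
          ∃ t : GroupLang.Term (Set.Iio k), t.realize (initial k v) = v k) := by
  -- The implication is written as a disjunction of literals: one that fails at `γ` holds, or `x_k`
  -- equals some term in the earlier variables.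
  have hP := computablePred_or
    (computablePred_and (computablePred_isLiteralCode k) (computablePred_holdsAt hγ).not)
    (computablePred_and (computablePred_fst_eq true)
      (computablePred_and
        (computablePred_comp (computablePred_isTermCode_Iio k) (Computable.fst.comp .snd))
        (computablePred_eq (Computable.snd.comp .snd) (.const (Nat.pair 0 k)))))
  obtain ⟨e, φ, hφ, hlit, hall⟩ := exists_code_literals hP fun b c d h => by
    rcases h with ⟨⟨hc, hd⟩, -⟩ | ⟨-, hc, hd⟩
    · exact ⟨termCode_ofCode_of_isTermCode hc, termCode_ofCode_of_isTermCode hd⟩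
    · simp only at hc hd
      exact ⟨termCode_ofCode_of_isTermCode hc, by simp [hd]⟩
  have hlt : Set.Iio k ⊆ Set.Iio (k + 1) := Set.Iio_subset_Iio (Nat.le_succ k)
  refine ⟨disj (ceSet e) φ, ⟨_, .disj e hφ⟩,
    .disj (ceSet e) (fun _ => []) (fun _ => 0) φ (fun _ => Nat.one_pos) fun w => ?_, ?_, ?_⟩
  · obtain ⟨b, t, u, -, h⟩ := hlit w
    exact h ▸ .qf (isQF_literal b t u)
  · refine Set.iUnion_subset fun w => ?_
    obtain ⟨b, t, u, hP, h⟩ := hlit w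
    rw [h, freeVars_literal]
    rcases hP with ⟨⟨ht, hu⟩, -⟩ | ⟨-, ht, hu⟩
    · obtain ⟨t, rfl⟩ := isTermCode_termCode.1 ht
      obtain ⟨u, rfl⟩ := isTermCode_termCode.1 hu
      exact Set.union_subset ((varFinset_relabel_val t).trans hlt)
        ((varFinset_relabel_val u).trans hlt)
    · obtain ⟨t, rfl⟩ := isTermCode_termCode.1 ht
      simp only [← termCode_var] at hu
      rw [termCode_injective hu]
      exact Set.union_subset ((varFinset_relabel_val t).trans hlt)
        (by simp [Language.Term.varFinset])
  · intro M _ v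
    constructor
    · rintro ⟨w, hw⟩ hsame
      obtain ⟨b, t, u, hP, h⟩ := hlit w
      rw [h, realize_literal] at hw
      rcases hP with ⟨⟨ht, hu⟩, hb⟩ | ⟨hb, ht, hu⟩
      · obtain ⟨t, rfl⟩ := isTermCode_termCode.1 ht
        obtain ⟨u, rfl⟩ := isTermCode_termCode.1 hu
        rw [holdsAt_iff] at hb
        simp only [realize_relabel_val] at hb hw
        exact absurd (hw.trans (hsame t u)) hb
      · obtain ⟨t, rfl⟩ := isTermCode_termCode.1 ht
        simp only [← termCode_var] at hu
        rw [termCode_injective hu, realize_relabel_val] at hw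
        exact ⟨t, hw.1 hb⟩
    · intro h
      by_cases hsame : SameAtomicType (initial k v) (initial k γ)
      · obtain ⟨t, ht⟩ := h hsame
        obtain ⟨w, hw⟩ := hall true (t.relabel Subtype.val) (.var k)
          (Or.inr ⟨rfl, ⟨t, rfl⟩, termCode_var k⟩)
        refine ⟨w, ?_⟩
        rw [hw, realize_literal, realize_relabel_val]
        simpa using ht
      · simp only [SameAtomicType, not_forall] at hsame
        obtain ⟨t, u, htu⟩ := hsame
        let b : Bool := @decide (t.realize (initial k v) = u.realize (initial k v))
          (Classical.propDecidable _)
        have hb : b = true ↔ t.realize (initial k v) = u.realize (initial k v) := by simp [b]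
        obtain ⟨w, hw⟩ := hall b (t.relabel Subtype.val) (u.relabel Subtype.val)
          (Or.inl ⟨⟨⟨t, rfl⟩, ⟨u, rfl⟩⟩, by
            rw [holdsAt_iff, realize_relabel_val, realize_relabel_val, hb]; exact htu⟩)
        refine ⟨w, ?_⟩
        rw [hw, realize_literal, realize_relabel_val, realize_relabel_val, hb]

end CoHopfian

theorem exists_scottSentence_of_isCoHopfian {G : Type u} [Group G] [Group.FG G]
    (hG : IsComputableStructure G) (hco : IsCoHopfian G) :
    ∃ φ : InfFormula, φ.IsComputable ∧ φ.IsDSigma 2 ∧ φ.IsScottSentence G := by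
  obtain ⟨l, hl⟩ := exists_list_closure_eq_top G
  let γ : ℕ → G := fun i => l[i]?.getD 1
  let k := l.length
  have hgen : ∀ g, ∃ t : GroupLang.Term (Set.Iio k), t.realize (initial k γ) = g := by
    intro g
    refine exists_realize_eq _ ?_
    have : Subgroup.closure {g | g ∈ l} ≤ Subgroup.closure (Set.range (initial k γ)) := by
      refine Subgroup.closure_mono fun x hx => ?_
      obtain ⟨i, hi, rfl⟩ := List.getElem_of_mem hx
      exact ⟨⟨i, hi⟩, by simp [γ, hi, initial]⟩
    exact this (hl ▸ Subgroup.mem_top g)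
  have hγ : ComputablePred fun p : ℕ × ℕ =>
      (ofCode p.1).realize γ = (ofCode p.2).realize γ := computablePred_realize_eq hG l 1
  obtain ⟨φ, hφ, hφPi, hφv, hφr⟩ := exists_isPi_one_atomicType k γ hγ
  obtain ⟨ψ, hψ, hψSigma, hψv, hψr⟩ := exists_isSigma_one_generates k γ hγ
  obtain ⟨c, hc, hσ⟩ := (hφ.exs (List.range k)).disj_singleton
  obtain ⟨d, hd, hπ⟩ := (hψ.alls (List.range (k + 1))).conj_singleton
  refine ⟨.and (disj {c} fun _ => exs (List.range k) φ)
    (conj {d} fun _ => alls (List.range (k + 1)) ψ), ⟨_, .and hσ hπ⟩,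
    ⟨_, _, .disj {c} (fun _ => List.range k) (fun _ => 1) (fun _ => φ)
      (fun _ => Nat.one_lt_two) fun _ => hφPi,
    .conj {d} (fun _ => List.range (k + 1)) (fun _ => 1) (fun _ => ψ)
      (fun _ => Nat.one_lt_two) fun _ => hψSigma, rfl⟩, ?_, ?_⟩
  · refine Set.eq_empty_iff_forall_notMem.2 fun i hi => ?_
    rcases hi with hi | hi
    · obtain ⟨_, hi⟩ := Set.mem_iUnion.1 hi
      rw [freeVars_exs] at hi
      exact hi.2 (List.mem_range.2 (hφv hi.1))
    · obtain ⟨_, hi⟩ := Set.mem_iUnion.1 hi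
      rw [freeVars_alls] at hi
      exact hi.2 (List.mem_range.2 (hψv hi.1))
  · intro M _ _
    constructor
    · intro h
      -- Any assignment will do for a sentence; the constant `1` supplies one.
      obtain ⟨⟨_, hσ⟩, hπ⟩ := h fun _ => sOne
      obtain ⟨v, -, hv⟩ := (realize_exs _ _ _).1 hσ
      rw [hφr] at hv
      refine hv.nonempty_equiv (fun a => ?_) hgen
      -- To see that `a` is generated, the universal conjunct is instantiated at the tuple `v` with
      -- `a` as the value of `x_k`.
      have hu : initial k (fun i => if i < k then v i else if i = k then a else sOne) =
          initial k v := by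
        funext ⟨i, hi⟩
        exact if_pos hi
      have := (realize_alls _ _ _).1 (hπ ⟨d, rfl⟩)
        (fun i => if i < k then v i else if i = k then a else sOne) fun i hi => by
          rw [List.mem_range] at hi
          rw [if_neg (by omega), if_neg (by omega)]
      rw [hψr, hu] at this
      simpa using this hv
    · rintro ⟨e⟩ v
      have he := sameAtomicType_equiv e.symm (initial k γ)
      refine ⟨⟨⟨c, rfl⟩, (realize_exs _ _ _).2
        ⟨fun i => if i < k then e.symm (γ i) else v i, fun i hi => ?_, ?_⟩⟩, fun _ =>
        (realize_alls _ _ _).2 fun v' _ => ?_⟩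
      · rw [List.mem_range] at hi
        exact if_neg hi
      · rw [hφr]
        have hu : initial k (fun i => if i < k then e.symm (γ i) else v i) =
            fun i => e.symm (initial k γ i) := by
          funext ⟨i, hi⟩
          exact if_pos hi
        rw [hu]
        exact he.symm
      · rw [hψr]
        intro hv'
        -- Moving the tuple into `G` along `e` preserves its type, so the co-Hopfian property
        -- applies there.
        have h' := (sameAtomicType_equiv e (initial k v')).symm.trans hv'
        obtain ⟨t, ht⟩ := hco.exists_realize_eq h' hgen (e (v' k))
        rw [realize_equiv] at ht
        exact ⟨t, e.injective ht⟩

end InfFormula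

end CompGroup

theorem mainTheorem11 (G : Type*) [Group G] [Group.FG G]
    (hG : CompGroup.IsComputableStructure G) :
    (¬ CompGroup.IsCoHopfian G → CompGroup.IsSigmaTwoHard (CompGroup.indexSet G)) ∧
    (CompGroup.IsCoHopfian G →
      ∃ φ : CompGroup.InfFormula,
        φ.IsComputable ∧ φ.IsDSigma 2 ∧ φ.IsScottSentence G) :=
  ⟨CompGroup.isSigmaTwoHard_of_not_isCoHopfian hG,
    CompGroup.InfFormula.exists_scottSentence_of_isCoHopfian hG⟩
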